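/- Let $\mathbb F$ be an algebraically closed field and let $q\in\mathbb F$ be nonzero and not a root of unity. Let $\triangle_q$ be the universal Askey--Wilson algebra: the unital associative $\mathbb F$-algebra with generators $A,B,C$ and the relations that each of $$A+\frac{qBC-q^{-1}CB}{q^2-q^{-2}},\qquad B+\frac{qCA-q^{-1}AC}{q^2-q^{-2}},\qquad C+\frac{qAB-q^{-1}BA}{q^2-q^{-2}}$$ commutes with $A,B,C$. Let $\mathfrak H_q$ be the universal DAHA of type $(C_1^\vee,C_1)$: the unital associative $\mathbb F$-algebra with generators $t_i^{\pm1}$ ($i=0,1,2,3$) and the relations $t_it_i^{-1}=t_i^{-1}t_i=1$, $t_i+t_i^{-1}$ is central, $t_0t_1t_2t_3=q^{-1}$. Each $\mathfrak H_q$-module is viewed as a $\triangle_q$-module via the algebra homomorphism $\triangle_q\to\mathfrak H_q$ with $$A\mapsto t_1t_0+(t_1t_0)^{-1},\quad B\mapsto t_3t_0+(t_3t_0)^{-1},\quad C\mapsto t_2t_0+(t_2t_0)^{-1}.$$ Let $d\ge1$ be an odd integer and let $k_0,k_1,k_2,k_3\in\mathbb F$ be nonzero with $k_0^2=q^{-d-1}$.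 Let $E(k_0,k_1,k_2,k_3)$ be the $(d+1)$-dimensional $\mathfrak H_q$-module with $\mathbb F$-basis $v_0,\dots,v_d$ on which the generators act as follows. Put $\varrho_i=(k_0k_1k_3q^i-k_2)(k_0k_1k_3q^i-k_2^{-1})$ for odd $i$ and $\varrho_i=(1-q^i)(1-k_0^2q^i)$ for even $i$. Then * $t_0v_0=k_0v_0$, $t_0v_d=k_0v_d$, $t_0v_i=k_0^{-1}q^{-i}\varrho_iv_{i-1}+(k_0+k_0^{-1}-k_0^{-1}q^{-i})v_i$ for $i=2,4,\dots,d-1$, and $t_0v_i=k_0^{-1}q^{-i-1}(v_i-v_{i+1})$ for $i=1,3,\dots,d-2$; * $t_1v_0=k_1v_0+k_1^{-1}v_1$, $t_1v_i=-k_1\varrho_iv_{i-1}+k_1v_i+k_1^{-1}v_{i+1}$ for $i=2,4,\dots,d-1$, and $t_1v_i=k_1^{-1}v_i$ for $i=1,3,\dots,d$; * $t_2v_i=k_0^{-1}k_1^{-1}k_3^{-1}q^{-i-1}(v_i-v_{i+1})$ for $i=0,2,\dots,d-1$, and $t_2v_i=\dfrac{\varrho_i}{k_0k_1k_3q^i}v_{i-1}+(k_2+k_2^{-1}-k_0^{-1}k_1^{-1}k_3^{-1}q^{-i})v_i$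 for $i=1,3,\dots,d$; * $t_3v_i=k_3v_i$ for $i=0,2,\dots,d-1$, $t_3v_i=-k_3^{-1}\varrho_iv_{i-1}+k_3^{-1}v_i+k_3v_{i+1}$ for $i=1,3,\dots,d-2$, and $t_3v_d=-k_3^{-1}\varrho_dv_{d-1}+k_3^{-1}v_d$; and each $t_i+t_i^{-1}$ acts as the scalar $k_i+k_i^{-1}$. Let $E^{2}=E(k_0,k_1,k_2,k_3)^{2\bmod 4}$ be the $\mathfrak H_q$-module obtained by twisting $E(k_0,k_1,k_2,k_3)$ by the automorphism of $\mathfrak H_q$ that sends $t_0,t_1,t_2,t_3$ to $t_2,t_3,t_0,t_1$, respectively. For $\theta\in\mathbb F$ let $E^{2}(\theta)=\{v\in E^{2}\mid t_0v=\theta v\}$, which is a $\triangle_q$-submodule of $E^2$. Assume that the $\mathfrak H_q$-module $E(k_0,k_1,k_2,k_3)$ is irreducible. 1. If $k_2^2=1$, then the $\triangle_q$-submodules of $E^{2}$ are exactly $\{0\}$, $E^{2}(k_2)$ and $E^{2}$, and $\{0\}\subsetneq E^{2}(k_2)\subsetneq E^{2}$. 2. If $k_2^2\neq1$, then the $\triangle_q$-submodules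 of $E^{2}$ are exactly $\{0\}$, $E^{2}(k_2)$, $E^{2}(k_2^{-1})$ and $E^{2}$; here $E^{2}(k_2)$ and $E^{2}(k_2^{-1})$ are nonzero and proper, and neither contains the other. -/

import Mathlib

/-- `q` is a nonzero scalar that is not a root of unity. -/
class NonRootOfUnity {F : Type*} [Field F] (q : F) : Prop where
  ne_zero : q ≠ 0
  pow_ne_one : ∀ n : ℕ, 0 < n → q ^ n ≠ 1

/-- The generators `A, B, C` of the universal Askey–Wilson algebra. -/
inductive UAWGen
  | A
  | B
  | C

/-- `x + (q y z - q⁻¹ z y) / (q ^ 2 - q⁻²)`, in an arbitrary `F`-algebra. -/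
def awExpr {F R : Type*} [Field F] [Ring R] [Algebra F R] (q : F) (x y z : R) : R :=
  x + (q ^ 2 - (q ^ 2)⁻¹)⁻¹ • (q • (y * z) - q⁻¹ • (z * y))

/-- The defining relations of the universal Askey–Wilson algebra: each of
`A + (q BC - q⁻¹ CB)/(q² - q⁻²)`, `B + (q CA - q⁻¹ AC)/(q² - q⁻²)`,
`C + (q AB - q⁻¹ BA)/(q² - q⁻²)` commutes with each of the generators `A, B, C`. -/
inductive UAWRel {F : Type*} [Field F] (q : F) :
    FreeAlgebra F UAWGen → FreeAlgebra F UAWGen → Prop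
  | commA (g : UAWGen) : UAWRel q
      (awExpr q (FreeAlgebra.ι F UAWGen.A) (FreeAlgebra.ι F UAWGen.B) (FreeAlgebra.ι F UAWGen.C)
        * FreeAlgebra.ι F g)
      (FreeAlgebra.ι F g *
        awExpr q (FreeAlgebra.ι F UAWGen.A) (FreeAlgebra.ι F UAWGen.B) (FreeAlgebra.ι F UAWGen.C))
  | commB (g : UAWGen) : UAWRel q
      (awExpr q (FreeAlgebra.ι F UAWGen.B) (FreeAlgebra.ι F UAWGen.C) (FreeAlgebra.ι F UAWGen.A)
        * FreeAlgebra.ι F g)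
      (FreeAlgebra.ι F g *
        awExpr q (FreeAlgebra.ι F UAWGen.B) (FreeAlgebra.ι F UAWGen.C) (FreeAlgebra.ι F UAWGen.A))
  | commC (g : UAWGen) : UAWRel q
      (awExpr q (FreeAlgebra.ι F UAWGen.C) (FreeAlgebra.ι F UAWGen.A) (FreeAlgebra.ι F UAWGen.B)
        * FreeAlgebra.ι F g)
      (FreeAlgebra.ι F g *
        awExpr q (FreeAlgebra.ι F UAWGen.C) (FreeAlgebra.ι F UAWGen.A) (FreeAlgebra.ι F UAWGen.B))

/-- The universal Askey–Wilson algebra `△_q`. -/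
def UAW {F : Type*} [Field F] (q : F) : Type _ := RingQuot (UAWRel q)

instance {F : Type*} [Field F] (q : F) : Ring (UAW q) :=
  inferInstanceAs (Ring (RingQuot (UAWRel q)))

instance {F : Type*} [Field F] (q : F) : Algebra F (UAW q) :=
  inferInstanceAs (Algebra F (RingQuot (UAWRel q)))

/-- The generators of the universal DAHA of type `(C₁^∨, C₁)`: the symbols `t i` and `tinv i`
(the latter standing for `t_i⁻¹`), `i = 0, 1, 2, 3`. -/
inductive DAHAGen
  | t (i : Fin 4)
  | tinv (i : Fin 4)

/-- The defining relations of the universal DAHA of type `(C₁^∨, C₁)`. -/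
inductive DAHARel {F : Type*} [Field F] (q : F) :
    FreeAlgebra F DAHAGen → FreeAlgebra F DAHAGen → Prop
  | mul_inv (i : Fin 4) : DAHARel q
      (FreeAlgebra.ι F (DAHAGen.t i) * FreeAlgebra.ι F (DAHAGen.tinv i)) 1
  | inv_mul (i : Fin 4) : DAHARel q
      (FreeAlgebra.ι F (DAHAGen.tinv i) * FreeAlgebra.ι F (DAHAGen.t i)) 1
  | central (i : Fin 4) (x : FreeAlgebra F DAHAGen) : DAHARel q
      ((FreeAlgebra.ι F (DAHAGen.t i) + FreeAlgebra.ι F (DAHAGen.tinv i)) * x)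
      (x * (FreeAlgebra.ι F (DAHAGen.t i) + FreeAlgebra.ι F (DAHAGen.tinv i)))
  | prod : DAHARel q
      (FreeAlgebra.ι F (DAHAGen.t 0) * FreeAlgebra.ι F (DAHAGen.t 1) *
        FreeAlgebra.ι F (DAHAGen.t 2) * FreeAlgebra.ι F (DAHAGen.t 3))
      (algebraMap F _ q⁻¹)

/-- The universal DAHA `ℌ_q` of type `(C₁^∨, C₁)`. -/
def DAHA {F : Type*} [Field F] (q : F) : Type _ := RingQuot (DAHARel q)

instance {F : Type*} [Field F] (q : F) : Ring (DAHA q) :=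
  inferInstanceAs (Ring (RingQuot (DAHARel q)))

instance {F : Type*} [Field F] (q : F) : Algebra F (DAHA q) :=
  inferInstanceAs (Algebra F (RingQuot (DAHARel q)))

namespace UAW

variable {F : Type*} [Field F] (q : F)

/-- The quotient map from the free algebra. -/
def mk : FreeAlgebra F UAWGen →ₐ[F] UAW q := RingQuot.mkAlgHom F (UAWRel q)

/-- The generators of `△_q`. -/
def gen (g : UAWGen) : UAW q := mk q (FreeAlgebra.ι F g)

variable {q}

/-- The universal property of `△_q`. -/
def lift {R : Type*} [Ring R] [Algebra F R] (f : UAWGen → R)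
    (hA : ∀ g, Commute (awExpr q (f .A) (f .B) (f .C)) (f g))
    (hB : ∀ g, Commute (awExpr q (f .B) (f .C) (f .A)) (f g))
    (hC : ∀ g, Commute (awExpr q (f .C) (f .A) (f .B)) (f g)) : UAW q →ₐ[F] R :=
  RingQuot.liftAlgHom F ⟨FreeAlgebra.lift F f, by
    intro x y h
    cases h with
    | commA g => simpa [awExpr] using (hA g).eq
    | commB g => simpa [awExpr] using (hB g).eq
    | commC g => simpa [awExpr] using (hC g).eq⟩

theorem lift_mk {R : Type*} [Ring R] [Algebra F R] (f : UAWGen → R) (hA hB hC)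
    (x : FreeAlgebra F UAWGen) :
    lift (q := q) f hA hB hC (mk q x) = FreeAlgebra.lift F f x :=
  RingQuot.liftAlgHom_mkAlgHom_apply _ _ _ _

theorem mk_surjective : Function.Surjective (mk q) := RingQuot.mkAlgHom_surjective F _

end UAW

namespace DAHA

variable {F : Type*} [Field F] (q : F)

/-- The quotient map from the free algebra. -/
def mk : FreeAlgebra F DAHAGen →ₐ[F] DAHA q := RingQuot.mkAlgHom F (DAHARel q)

/-- The generator `t_i`. -/
def t (i : Fin 4) : DAHA q := mk q (FreeAlgebra.ι F (DAHAGen.t i))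

/-- The generator `t_i⁻¹`. -/
def tinv (i : Fin 4) : DAHA q := mk q (FreeAlgebra.ι F (DAHAGen.tinv i))

theorem mk_surjective : Function.Surjective (mk q) := RingQuot.mkAlgHom_surjective F _

theorem t_mul_tinv (i : Fin 4) : t q i * tinv q i = 1 := by
  have := RingQuot.mkAlgHom_rel F (DAHARel.mul_inv (q := q) i)
  rw [map_mul, map_one] at this
  exact this

theorem tinv_mul_t (i : Fin 4) : tinv q i * t q i = 1 := by
  have := RingQuot.mkAlgHom_rel F (DAHARel.inv_mul (q := q) i)
  rw [map_mul, map_one] at this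
  exact this

theorem c_central (i : Fin 4) (x : DAHA q) :
    (t q i + tinv q i) * x = x * (t q i + tinv q i) := by
  obtain ⟨x, rfl⟩ := mk_surjective q x
  have := RingQuot.mkAlgHom_rel F (DAHARel.central (q := q) i x)
  rw [map_mul, map_mul, map_add] at this
  exact this

theorem t_prod : t q 0 * t q 1 * t q 2 * t q 3 = algebraMap F _ q⁻¹ := by
  have := RingQuot.mkAlgHom_rel F (DAHARel.prod (q := q))
  rw [map_mul, map_mul, map_mul, AlgHom.commutes] at this
  exact this

variable {q}

/-- The universal property of `ℌ_q`. -/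
def lift {R : Type*} [Ring R] [Algebra F R] (f g : Fin 4 → R)
    (h1 : ∀ i, f i * g i = 1) (h2 : ∀ i, g i * f i = 1)
    (h3 : ∀ i j, Commute (f i + g i) (f j))
    (h4 : f 0 * f 1 * f 2 * f 3 = algebraMap F R q⁻¹) : DAHA q →ₐ[F] R :=
  RingQuot.liftAlgHom F ⟨FreeAlgebra.lift F (fun x => match x with
      | .t i => f i
      | .tinv i => g i), by
    intro x y h
    cases h with
    | mul_inv i => simpa using h1 i
    | inv_mul i => simpa using h2 i
    | central i x =>
      simp only [map_mul, map_add, FreeAlgebra.lift_ι_apply]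
      induction x using FreeAlgebra.induction with
      | grade0 r => rw [AlgHom.commutes]; exact (Algebra.commutes r _).symm
      | grade1 x =>
        rw [FreeAlgebra.lift_ι_apply]
        rcases x with j | j
        · exact (h3 i j).eq
        · change (f i + g i) * g j = g j * (f i + g i)
          calc (f i + g i) * g j = g j * f j * ((f i + g i) * g j) := by rw [h2, one_mul]
            _ = g j * ((f j * (f i + g i)) * g j) := by simp only [mul_assoc]
            _ = g j * (((f i + g i) * f j) * g j) := by rw [(h3 i j).eq]
            _ = g j * (f i + g i) * (f j * g j) := by simp only [mul_assoc]
            _ = g j * (f i + g i) := by rw [h1, mul_one]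
      | mul a b ha hb => rw [map_mul, ← mul_assoc, ha, mul_assoc, hb, mul_assoc]
      | add a b ha hb => rw [map_add, mul_add, ha, hb, ← add_mul]
    | prod => simpa using h4⟩

theorem lift_t {R : Type*} [Ring R] [Algebra F R] (f g : Fin 4 → R) (h1 h2 h3 h4) (i : Fin 4) :
    lift (q := q) f g h1 h2 h3 h4 (t q i) = f i :=
  (RingQuot.liftAlgHom_mkAlgHom_apply _ _ _ _).trans (FreeAlgebra.lift_ι_apply _ _)

theorem lift_tinv {R : Type*} [Ring R] [Algebra F R] (f g : Fin 4 → R) (h1 h2 h3 h4)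
    (i : Fin 4) : lift (q := q) f g h1 h2 h3 h4 (tinv q i) = g i :=
  (RingQuot.liftAlgHom_mkAlgHom_apply _ _ _ _).trans (FreeAlgebra.lift_ι_apply _ _)

theorem hom_ext {R : Type*} [Ring R] [Algebra F R] (φ ψ : DAHA q →ₐ[F] R)
    (h1 : ∀ i, φ (t q i) = ψ (t q i)) (h2 : ∀ i, φ (tinv q i) = ψ (tinv q i)) : φ = ψ := by
  refine RingQuot.ringQuot_ext' _ _ _ (FreeAlgebra.hom_ext (funext fun x => ?_))
  rcases x with i | i
  · exact h1 i
  · exact h2 i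

/-- The endomorphism of `ℌ_q` with `t_i ↦ t_{i + m}` (indices modulo `4`). -/
def shiftHom (m : Fin 4) : DAHA q →ₐ[F] DAHA q :=
  lift (fun i => t q (i + m)) (fun i => tinv q (i + m)) (fun _ => t_mul_tinv q _)
    (fun _ => tinv_mul_t q _) (fun _ _ => c_central q _ _) (by
      have h1 : t q 1 * t q 2 * t q 3 * t q 0 = algebraMap F _ q⁻¹ := by
        have h := t_prod q
        calc t q 1 * t q 2 * t q 3 * t q 0
            = tinv q 0 * (t q 0 * t q 1 * t q 2 * t q 3) * t q 0 := by
              simp only [← mul_assoc, tinv_mul_t, one_mul]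
          _ = _ := by rw [h, ← Algebra.commutes, mul_assoc, tinv_mul_t, mul_one]
      have h2 : t q 2 * t q 3 * t q 0 * t q 1 = algebraMap F _ q⁻¹ := by
        calc t q 2 * t q 3 * t q 0 * t q 1
            = tinv q 1 * (t q 1 * t q 2 * t q 3 * t q 0) * t q 1 := by
              simp only [← mul_assoc, tinv_mul_t, one_mul]
          _ = _ := by rw [h1, ← Algebra.commutes, mul_assoc, tinv_mul_t, mul_one]
      have h3 : t q 3 * t q 0 * t q 1 * t q 2 = algebraMap F _ q⁻¹ := by
        calc t q 3 * t q 0 * t q 1 * t q 2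
            = tinv q 2 * (t q 2 * t q 3 * t q 0 * t q 1) * t q 2 := by
              simp only [← mul_assoc, tinv_mul_t, one_mul]
          _ = _ := by rw [h2, ← Algebra.commutes, mul_assoc, tinv_mul_t, mul_one]
      fin_cases m
      · exact t_prod q
      · exact h1
      · exact h2
      · exact h3)

theorem shiftHom_t (m i : Fin 4) : shiftHom m (t q i) = t q (i + m) := lift_t _ _ _ _ _ _ _

theorem shiftHom_tinv (m i : Fin 4) : shiftHom m (tinv q i) = tinv q (i + m) :=
  lift_tinv _ _ _ _ _ _ _

theorem shiftHom_comp_neg (m : Fin 4) :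
    (shiftHom (q := q) m).comp (shiftHom (-m)) = AlgHom.id F _ := by
  apply hom_ext <;> intro i <;> simp [shiftHom_t, shiftHom_tinv]

variable (q) in
/-- The action of `m ∈ ℤ/4ℤ` on `ℌ_q`: the automorphism with `t_i ↦ t_{i + m}`. -/
def shift (m : Fin 4) : DAHA q ≃ₐ[F] DAHA q :=
  AlgEquiv.ofAlgHom (shiftHom m) (shiftHom (-m)) (shiftHom_comp_neg m)
    (by simpa using shiftHom_comp_neg (q := q) (-m))

end DAHA

theorem daha_swap {R : Type*} [Ring R] {s S x X : R}
    (h0 : ∀ y, (s + S) * y = y * (s + S)) (hx : ∀ y, (x + X) * y = y * (x + X)) :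
    s * x + X * S = x * s + S * X := by
  have e1 := h0 x
  have e2 := hx S
  simp only [add_mul, mul_add] at e1 e2
  linear_combination (norm := abel) e1 + e2

/-- `t_0` commutes with `t_j t_0 + (t_j t_0)⁻¹`. -/
theorem daha_commute {R : Type*} [Ring R] {s S x X : R} (hs : s * S = 1) (hS : S * s = 1)
    (h0 : ∀ y, (s + S) * y = y * (s + S)) (hx : ∀ y, (x + X) * y = y * (x + X)) :
    Commute s (x * s + S * X) := by
  have h := daha_swap h0 hx
  calc s * (x * s + S * X) = (s * x + X * S) * s := by
        rw [mul_add, add_mul, mul_assoc X S s, hS, ← mul_assoc, ← mul_assoc, hs, one_mul, mul_one]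
    _ = (x * s + S * X) * s := by rw [h]

/-- The identity behind the three relations of the universal Askey–Wilson algebra. -/
theorem daha_key_scalar {K R : Type*} [CommRing K] [Ring R] [Algebra K R] (q p c0 c1 c2 c3 : K)
    (hq : q * p = 1) (s t1 t2 t3 : R) (hs : s * s = c0 • s - 1) (h1 : t1 * t1 = c1 • t1 - 1)
    (h2 : t2 = p • ((c1 • 1 - t1) * (c0 • 1 - s) * (c3 • 1 - t3)))
    (h2' : c2 • 1 - t2 = q • (t3 * s * t1)) :
    (q ^ 2 - p ^ 2) • (t2 * s + (c0 • 1 - s) * (c2 • 1 - t2))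
      + (q • ((t1 * s + (c0 • 1 - s) * (c1 • 1 - t1)) * (t3 * s + (c0 • 1 - s) * (c3 • 1 - t3)))
        - p • ((t3 * s + (c0 • 1 - s) * (c3 • 1 - t3)) * (t1 * s + (c0 • 1 - s) * (c1 • 1 - t1))))
      = (q - p) • ((c1 * c3) • (1 : R) + c2 • (q • (c0 • 1 - s) + p • s)) := by
  have hc : c2 • (1 : R) = p • ((c1 • 1 - t1) * (c0 • 1 - s) * (c3 • 1 - t3))
      + q • (t3 * s * t1) := by rw [← h2, ← h2']; abel
  have hW : ∀ y : R, c2 • y = (p • ((c1 • 1 - t1) * (c0 • 1 - s) * (c3 • 1 - t3))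
      + q • (t3 * s * t1)) * y := fun y => by rw [← hc, smul_mul_assoc, one_mul]
  have hC : ∀ y : R, (p • ((c1 • 1 - t1) * (c0 • 1 - s) * (c3 • 1 - t3))
      + q • (t3 * s * t1)) * y = y * (p • ((c1 • 1 - t1) * (c0 • 1 - s) * (c3 • 1 - t3))
      + q • (t3 * s * t1)) := fun y => by
    rw [← hc, smul_mul_assoc, one_mul, mul_smul_comm, mul_one]
  have k1 := hC s
  have k2 := hC t1
  have k3 := congrArg (· * t1) k2
  have k4 := congrArg (s * ·) k2
  have k5 := congrArg (s * ·) k3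
  have k6 := congrArg (fun y => t1 * (y * s)) k2
  have hs' : ∀ y, s * (s * y) = c0 • (s * y) - y := fun y => by
    rw [← mul_assoc, hs, sub_mul, smul_mul_assoc, one_mul]
  have h1' : ∀ y, t1 * (t1 * y) = c1 • (t1 * y) - y := fun y => by
    rw [← mul_assoc, h1, sub_mul, smul_mul_assoc, one_mul]
  rw [h2', h2, hW]
  simp only [mul_add, add_mul, mul_sub, sub_mul, smul_mul_assoc, mul_smul_comm, mul_assoc, hs, hs',
    h1, h1', mul_one, one_mul, smul_sub, smul_add] at k1 k2 k3 k4 k5 k6 ⊢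
  linear_combination (norm := skip) (q * q - 1) • k1 + (c0 * c1) • k2 - c0 • k3 - c1 • k4
    + k5 - k6
  match_scalars <;> grind

theorem daha_key {F R : Type*} [Field F] [Ring R] [Algebra F R] {q : F} (hq : q ≠ 0)
    {s S t1 T1 t2 T2 t3 T3 : R} (hs' : S * s = 1)
    (h1' : T1 * t1 = 1) (h2 : t2 * T2 = 1) (h3 : t3 * T3 = 1)
    (c0 : ∀ y, (s + S) * y = y * (s + S)) (c1 : ∀ y, (t1 + T1) * y = y * (t1 + T1))
    (c2 : ∀ y, (t2 + T2) * y = y * (t2 + T2)) (c3 : ∀ y, (t3 + T3) * y = y * (t3 + T3))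
    (hp : s * t1 * t2 * t3 = algebraMap F R q⁻¹) :
    (q ^ 2 - q⁻¹ ^ 2) • (t2 * s + S * T2)
      + (q • ((t1 * s + S * T1) * (t3 * s + S * T3))
        - q⁻¹ • ((t3 * s + S * T3) * (t1 * s + S * T1)))
      = (q - q⁻¹) • ((t1 + T1) * (t3 + T3) + (t2 + T2) * (q • S + q⁻¹ • s)) := by
  let K := Subalgebra.center F R
  let _ : Algebra K R := Algebra.ofModule (fun r x y => mul_assoc (r : R) x y) (fun r x y => by
    change x * ((r : R) * y) = (r : R) * (x * y)
    rw [← mul_assoc, (Subalgebra.mem_center_iff.1 r.2 x), mul_assoc])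
  have mem : ∀ x : R, (∀ y, x * y = y * x) → x ∈ Subalgebra.center F R := fun x hx =>
    Subalgebra.mem_center_iff.2 fun y => (hx y).symm
  let d0 : K := ⟨s + S, mem _ c0⟩
  let d1 : K := ⟨t1 + T1, mem _ c1⟩
  let d2 : K := ⟨t2 + T2, mem _ c2⟩
  let d3 : K := ⟨t3 + T3, mem _ c3⟩
  have e0 : ∀ y : R, d0 • y = (s + S) * y := fun _ => rfl
  have e1 : ∀ y : R, d1 • y = (t1 + T1) * y := fun _ => rfl
  have e2 : ∀ y : R, d2 • y = (t2 + T2) * y := fun _ => rfl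
  have e3 : ∀ y : R, d3 • y = (t3 + T3) * y := fun _ => rfl
  have f0 : d0 • (1 : R) - s = S := by rw [e0]; noncomm_ring
  have f1 : d1 • (1 : R) - t1 = T1 := by rw [e1]; noncomm_ring
  have f2 : d2 • (1 : R) - t2 = T2 := by rw [e2]; noncomm_ring
  have f3 : d3 • (1 : R) - t3 = T3 := by rw [e3]; noncomm_ring
  have hQ : algebraMap F K q * algebraMap F K q⁻¹ = 1 := by
    rw [← map_mul, mul_inv_cancel₀ hq, map_one]
  have a1 : t2 = q⁻¹ • (T1 * S * T3) := by
    calc t2 = T1 * (S * (s * t1 * t2 * t3)) * T3 := by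
          rw [mul_assoc s, mul_assoc s, ← mul_assoc S, hs', one_mul, mul_assoc t1, ← mul_assoc T1,
            h1', one_mul, mul_assoc, h3, mul_one]
      _ = _ := by rw [hp, ← Algebra.commutes, ← Algebra.smul_def, mul_smul_comm, smul_mul_assoc]
  have a2 : T2 = q • (t3 * s * t1) := by
    have h4 : t3 * s * t1 * t2 = q⁻¹ • 1 := by
      calc t3 * s * t1 * t2 = t3 * (s * t1 * t2 * t3) * T3 := by
            simp only [mul_assoc, h3, mul_one]
        _ = q⁻¹ • 1 := by
            rw [hp, ← Algebra.commutes, mul_assoc, h3, mul_one, Algebra.algebraMap_eq_smul_one]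
    calc T2 = q • (q⁻¹ • 1 * T2) := by
          rw [smul_mul_assoc, one_mul, smul_smul, mul_inv_cancel₀ hq, one_smul]
      _ = _ := by rw [← h4, mul_assoc _ t2, h2, mul_one]
  have key := daha_key_scalar (algebraMap F K q) (algebraMap F K q⁻¹) d0 d1 d2 d3 hQ s t1 t2 t3
    (by rw [e0, add_mul, hs']; abel) (by rw [e1, add_mul, h1']; abel)
    (by rw [f0, f1, f3, algebraMap_smul]; exact a1)
    (by rw [f2, algebraMap_smul]; exact a2)
  rw [f0, f1, f2, f3] at key
  simp only [sub_smul, ← map_pow, algebraMap_smul, mul_smul, e1, e2, e3, mul_one] at key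
  rw [sub_smul, key, sub_smul]

theorem awExpr_eq {F R : Type*} [Field F] [Ring R] [Algebra F R] {q : F} [NonRootOfUnity q]
    {s S t1 T1 t2 T2 t3 T3 : R} (hs : s * S = 1) (hs' : S * s = 1)
    (h1' : T1 * t1 = 1) (h2 : t2 * T2 = 1) (h3 : t3 * T3 = 1)
    (c0 : ∀ y, (s + S) * y = y * (s + S)) (c1 : ∀ y, (t1 + T1) * y = y * (t1 + T1))
    (c2 : ∀ y, (t2 + T2) * y = y * (t2 + T2)) (c3 : ∀ y, (t3 + T3) * y = y * (t3 + T3))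
    (hp : s * t1 * t2 * t3 = algebraMap F R q⁻¹) {y : R} (hy : Commute s y) :
    Commute (awExpr q (t2 * s + S * T2) (t1 * s + S * T1) (t3 * s + S * T3)) y := by
  have hq : q ≠ 0 := NonRootOfUnity.ne_zero
  have hD : q ^ 2 - (q ^ 2)⁻¹ ≠ 0 := by
    intro h
    refine NonRootOfUnity.pow_ne_one (q := q) 4 (by norm_num) ?_
    field_simp at h
    linear_combination h
  have key := daha_key hq hs' h1' h2 h3 c0 c1 c2 c3 hp
  have hy' : Commute S y := by
    calc S * y = S * (y * s) * S := by rw [mul_assoc, mul_assoc, hs, mul_one]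
      _ = y * S := by rw [← hy.eq, ← mul_assoc S, hs', one_mul]
  have : awExpr q (t2 * s + S * T2) (t1 * s + S * T1) (t3 * s + S * T3)
      = (q ^ 2 - (q ^ 2)⁻¹)⁻¹ • ((q - q⁻¹) • ((t1 + T1) * (t3 + T3)
        + (t2 + T2) * (q • S + q⁻¹ • s))) := by
    rw [← key, smul_add, inv_pow, inv_smul_smul₀ hD, awExpr]
  rw [this]
  refine Commute.smul_left (Commute.smul_left (.add_left (.mul_left (c1 y) (c3 y))
    (.mul_left (c2 y) (.add_left (hy'.smul_left _) (hy.smul_left _)))) _) _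

namespace DAHA

variable {F : Type*} [Field F] (q : F)

/-- The images of `A, B, C` in `ℌ_q`: `A ↦ t₁t₀ + (t₁t₀)⁻¹`, `B ↦ t₃t₀ + (t₃t₀)⁻¹`,
`C ↦ t₂t₀ + (t₂t₀)⁻¹`. -/
def zetaGen : UAWGen → DAHA q
  | .A => t q 1 * t q 0 + tinv q 0 * tinv q 1
  | .B => t q 3 * t q 0 + tinv q 0 * tinv q 3
  | .C => t q 2 * t q 0 + tinv q 0 * tinv q 2

theorem commute_zetaGen (g : UAWGen) : Commute (t q 0) (zetaGen q g) := by
  cases g <;> exact daha_commute (t_mul_tinv q 0) (tinv_mul_t q 0) (c_central q 0) (c_central q _)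

/-- The elements `zetaGen q g` satisfy the defining relations of `△_q`. -/
theorem zetaGen_rel [NonRootOfUnity q] :
    (∀ g, Commute (awExpr q (zetaGen q .A) (zetaGen q .B) (zetaGen q .C)) (zetaGen q g)) ∧
    (∀ g, Commute (awExpr q (zetaGen q .B) (zetaGen q .C) (zetaGen q .A)) (zetaGen q g)) ∧
    (∀ g, Commute (awExpr q (zetaGen q .C) (zetaGen q .A) (zetaGen q .B)) (zetaGen q g)) := by
  have hm := t_mul_tinv q
  have hi := tinv_mul_t q
  have hc := c_central q
  have hp := t_prod q
  -- conjugation by `t₀`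
  have conj1 : ∀ i, t q 0 * t q i * tinv q 0 * (t q 0 * tinv q i * tinv q 0) = 1 := fun i => by
    calc _ = t q 0 * (t q i * (tinv q 0 * t q 0) * tinv q i) * tinv q 0 := by
          simp only [mul_assoc]
      _ = 1 := by rw [hi, mul_one, hm, mul_one, hm]
  have conj2 : ∀ i, t q 0 * tinv q i * tinv q 0 * (t q 0 * t q i * tinv q 0) = 1 := fun i => by
    calc _ = t q 0 * (tinv q i * (tinv q 0 * t q 0) * t q i) * tinv q 0 := by
          simp only [mul_assoc]
      _ = 1 := by rw [hi, mul_one, hi, mul_one, hm]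
  have conj3 : ∀ i, t q 0 * t q i * tinv q 0 + t q 0 * tinv q i * tinv q 0
      = t q i + tinv q i := fun i => by
    rw [← add_mul, ← mul_add, ← hc, mul_assoc, hm, mul_one]
  have conj4 : ∀ i, t q 0 * t q i * tinv q 0 * t q 0 + tinv q 0 * (t q 0 * tinv q i * tinv q 0)
      = t q i * t q 0 + tinv q 0 * tinv q i := fun i => by
    rw [mul_assoc _ (tinv q 0), hi, mul_one, mul_assoc (t q 0), ← mul_assoc (tinv q 0), hi, one_mul]
    exact daha_swap (hc 0) (hc i)
  have hp2 : t q 0 * t q 2 * t q 3 * (t q 0 * t q 1 * tinv q 0) = algebraMap F _ q⁻¹ := by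
    calc _ = t q 0 * (tinv q 1 * (tinv q 0 * (t q 0 * t q 1 * t q 2 * t q 3) * t q 0) * t q 1)
          * tinv q 0 := by
          simp only [← mul_assoc, hi, one_mul]
      _ = _ := by
          rw [hp, ← Algebra.commutes, mul_assoc _ (tinv q 0), hi, mul_one, ← Algebra.commutes,
            mul_assoc _ (tinv q 1), hi, mul_one, ← Algebra.commutes, mul_assoc, hm, mul_one]
  have hp3 : t q 0 * t q 3 * (t q 0 * t q 1 * tinv q 0) * (t q 0 * t q 2 * tinv q 0)
      = algebraMap F _ q⁻¹ := by
    calc _ = t q 0 * (t q 3 * (t q 0 * t q 1 * (tinv q 0 * t q 0) * t q 2)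
          * (t q 3 * tinv q 3)) * tinv q 0 := by rw [hm, mul_one]; simp only [mul_assoc]
      _ = t q 0 * (t q 3 * (t q 0 * t q 1 * t q 2 * t q 3) * tinv q 3) * tinv q 0 := by
          rw [hi, mul_one]; simp only [mul_assoc]
      _ = _ := by
          rw [hp, ← Algebra.commutes, mul_assoc _ (t q 3), hm, mul_one, ← Algebra.commutes,
            mul_assoc, hm, mul_one]
  refine ⟨fun g => ?_, fun g => ?_, fun g => ?_⟩
  · have := awExpr_eq (hm 0) (hi 0) (hi 3) (conj1 1) (conj1 2) (hc 0) (hc 3)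
      (by rw [conj3]; exact hc 1) (by rw [conj3]; exact hc 2) hp3 (commute_zetaGen q g)
    rwa [conj4, conj4] at this
  · have := awExpr_eq (hm 0) (hi 0) (hi 2) (hm 3) (conj1 1) (hc 0) (hc 2)
      (hc 3) (by rw [conj3]; exact hc 1) hp2 (commute_zetaGen q g)
    rwa [conj4] at this
  · exact awExpr_eq (hm 0) (hi 0) (hi 1) (hm 2) (hm 3) (hc 0) (hc 1) (hc 2) (hc 3) hp
      (commute_zetaGen q g)

/-- The homomorphism `ζ : △_q → ℌ_q`. -/
def zeta [NonRootOfUnity q] : UAW q →ₐ[F] DAHA q :=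
  UAW.lift (zetaGen q) (zetaGen_rel q).1 (zetaGen_rel q).2.1 (zetaGen_rel q).2.2

theorem zeta_mk [NonRootOfUnity q] (x : FreeAlgebra F UAWGen) :
    zeta q (UAW.mk q x) = FreeAlgebra.lift F (zetaGen q) x := UAW.lift_mk _ _ _ _ _

theorem zeta_gen [NonRootOfUnity q] (g : UAWGen) : zeta q (UAW.gen q g) = zetaGen q g := by
  rw [UAW.gen, zeta_mk, FreeAlgebra.lift_ι_apply]

end DAHA

/-- Parameters of the module `E(k₀, k₁, k₂, k₃)`: an odd integer `d ≥ 1` and nonzero scalars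
`k₀, k₁, k₂, k₃` with `k₀ ^ 2 = q ^ (-d - 1)`. -/
structure EParam {F : Type*} [Field F] (q : F) where
  d : ℕ
  k₀ : F
  k₁ : F
  k₂ : F
  k₃ : F
  odd_d : Odd d
  k₀_ne : k₀ ≠ 0
  k₁_ne : k₁ ≠ 0
  k₂_ne : k₂ ≠ 0
  k₃_ne : k₃ ≠ 0
  k₀_sq : k₀ ^ 2 = q ^ (-(d : ℤ) - 1)

/-- The underlying `(d + 1)`-dimensional vector space of `E(k₀, k₁, k₂, k₃)`. -/
def EModule {F : Type*} [Field F] {q : F} (p : EParam q) : Type _ := Fin (p.d + 1) → F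

instance {F : Type*} [Field F] {q : F} (p : EParam q) : AddCommGroup (EModule p) :=
  inferInstanceAs (AddCommGroup (Fin (p.d + 1) → F))

instance {F : Type*} [Field F] {q : F} (p : EParam q) : Module F (EModule p) :=
  inferInstanceAs (Module F (Fin (p.d + 1) → F))

namespace EModule

variable {F : Type*} [Field F] {q : F} (p : EParam q)

/-- The basis `v_0, …, v_d` of `E(k₀, k₁, k₂, k₃)`. -/
noncomputable def basis : Module.Basis (Fin (p.d + 1)) F (EModule p) := Pi.basisFun F (Fin (p.d + 1))

/-- The basis vectors indexed by natural numbers; `v i` is only used for `i ≤ d` in the formulas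
below, and is `0` for `i > d`. -/
noncomputable def v (i : ℕ) : EModule p := if h : i < p.d + 1 then basis p ⟨i, h⟩ else 0

/-- The vector `t_0 v_i`. -/
noncomputable def t0v (i : ℕ) : EModule p :=
  if i = 0 then p.k₀ • v p 0
  else if i = p.d then p.k₀ • v p p.d
  else if Even i then
    (p.k₀⁻¹ * q ^ (-(i : ℤ)) * (1 - q ^ i) * (1 - p.k₀ ^ 2 * q ^ i)) • v p (i - 1)
      + (p.k₀ + p.k₀⁻¹ - p.k₀⁻¹ * q ^ (-(i : ℤ))) • v p i
  else (p.k₀⁻¹ * q ^ (-(i : ℤ) - 1)) • (v p i - v p (i + 1))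

/-- The vector `t_1 v_i`. -/
noncomputable def t1v (i : ℕ) : EModule p :=
  if i = 0 then p.k₁ • v p 0 + p.k₁⁻¹ • v p 1
  else if Even i then
    (-p.k₁ * (1 - q ^ i) * (1 - p.k₀ ^ 2 * q ^ i)) • v p (i - 1)
      + p.k₁ • v p i + p.k₁⁻¹ • v p (i + 1)
  else p.k₁⁻¹ • v p i

/-- The vector `t_2 v_i`. -/
noncomputable def t2v (i : ℕ) : EModule p :=
  if Even i then
    (p.k₀⁻¹ * p.k₁⁻¹ * p.k₃⁻¹ * q ^ (-(i : ℤ) - 1)) • (v p i - v p (i + 1))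
  else
    ((p.k₀ * p.k₁ * p.k₃ * q ^ i - p.k₂) * (p.k₀ * p.k₁ * p.k₃ * q ^ i - p.k₂⁻¹)
        / (p.k₀ * p.k₁ * p.k₃ * q ^ i)) • v p (i - 1)
      + (p.k₂ + p.k₂⁻¹ - p.k₀⁻¹ * p.k₁⁻¹ * p.k₃⁻¹ * q ^ (-(i : ℤ))) • v p i

/-- The vector `t_3 v_i`. -/
noncomputable def t3v (i : ℕ) : EModule p :=
  if Even i then p.k₃ • v p i
  else if i = p.d then
    (-p.k₃⁻¹ * (p.k₀ * p.k₁ * p.k₃ * q ^ p.d - p.k₂)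
        * (p.k₀ * p.k₁ * p.k₃ * q ^ p.d - p.k₂⁻¹)) • v p (p.d - 1)
      + p.k₃⁻¹ • v p p.d
  else
    (-p.k₃⁻¹ * (p.k₀ * p.k₁ * p.k₃ * q ^ i - p.k₂)
        * (p.k₀ * p.k₁ * p.k₃ * q ^ i - p.k₂⁻¹)) • v p (i - 1)
      + p.k₃⁻¹ • v p i + p.k₃ • v p (i + 1)

/-- The vector `t_j v_i`. -/
noncomputable def tv : Fin 4 → ℕ → EModule p
  | 0 => t0v p
  | 1 => t1v p
  | 2 => t2v p
  | 3 => t3v p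

/-- The scalar `k_j`. -/
noncomputable def k : Fin 4 → F
  | 0 => p.k₀
  | 1 => p.k₁
  | 2 => p.k₂
  | 3 => p.k₃

/-- The linear map by which `t_j` acts. -/
noncomputable def T (j : Fin 4) : Module.End F (EModule p) := (basis p).constr F fun i => tv p j i

/-- The linear map by which `t_j⁻¹` acts. -/
noncomputable def Tinv (j : Fin 4) : Module.End F (EModule p) := (k p j + (k p j)⁻¹) • 1 - T p j

theorem T_v (j : Fin 4) {i : ℕ} (h : i < p.d + 1) : T p j (v p i) = tv p j i := by
  rw [v, dif_pos h, T, Module.Basis.constr_basis]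

theorem v_zero {i : ℕ} (h : p.d < i) : v p i = 0 := by
  rw [v, dif_neg (by omega)]

theorem k₀_sq_mul [NonRootOfUnity q] : p.k₀ ^ 2 * q ^ (p.d + 1) = 1 := by
  have hq : q ≠ 0 := NonRootOfUnity.ne_zero
  rw [p.k₀_sq, ← zpow_natCast, ← zpow_add₀ hq]
  simp

theorem zpow_aux [NonRootOfUnity q] (i : ℕ) : q ^ (-(i : ℤ) - 1) = (q ^ i * q)⁻¹ := by
  have hq : q ≠ 0 := NonRootOfUnity.ne_zero
  rw [← neg_add', zpow_neg, zpow_add₀ hq, zpow_natCast, zpow_one]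

/-! The formulas for the action without case distinctions at the ends. Here `x` stands for
`q ^ i`, with `i` even. -/

theorem T_zero_even [NonRootOfUnity q] (m : ℕ) : T p 0 (v p (2 * m)) =
    (p.k₀⁻¹ * (q ^ (2 * m))⁻¹ * (1 - q ^ (2 * m)) * (1 - p.k₀ ^ 2 * q ^ (2 * m))) • v p (2 * m - 1)
      + (p.k₀ + p.k₀⁻¹ - p.k₀⁻¹ * (q ^ (2 * m))⁻¹) • v p (2 * m) := by
  obtain ⟨n, hn⟩ := p.odd_d
  rcases Nat.lt_or_ge p.d (2 * m) with h | h
  · rw [v_zero p h, map_zero, smul_zero, add_zero]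
    rcases Nat.lt_or_ge (p.d + 1) (2 * m) with h' | h'
    · rw [v_zero p (by omega), smul_zero]
    · rw [show 2 * m = p.d + 1 by omega, k₀_sq_mul]; simp
  · rw [T_v p _ (by omega)]
    simp only [tv, t0v]
    split_ifs with h1 h2 h3
    · simp [h1]
    · omega
    · rw [zpow_neg, zpow_natCast]
    · exact absurd (even_two_mul m) h3

theorem T_zero_odd [NonRootOfUnity q] (m : ℕ) : T p 0 (v p (2 * m + 1)) =
    (p.k₀⁻¹ * (q ^ (2 * m + 1) * q)⁻¹) • (v p (2 * m + 1) - v p (2 * m + 2)) := by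
  obtain ⟨n, hn⟩ := p.odd_d
  rcases Nat.lt_or_ge p.d (2 * m + 1) with h | h
  · simp [v_zero p h, v_zero p (show p.d < 2 * m + 2 by omega)]
  · rw [T_v p _ (by omega)]
    simp only [tv, t0v]
    rw [if_neg (by omega)]
    split_ifs with h1 h3
    · have := k₀_sq_mul p
      have hk := p.k₀_ne
      rw [← h1] at this
      rw [v_zero p (show p.d < 2 * m + 2 by omega), ← h1, sub_zero]
      congr 1
      rw [← pow_succ]
      have hne : q ^ (2 * m + 1 + 1) ≠ 0 := fun h => by simp [h] at this
      field_simp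
      exact this
    · exact absurd h3 (by simp)
    · rw [zpow_aux]

theorem T_one_even [NonRootOfUnity q] (m : ℕ) : T p 1 (v p (2 * m)) =
    (-p.k₁ * (1 - q ^ (2 * m)) * (1 - p.k₀ ^ 2 * q ^ (2 * m))) • v p (2 * m - 1)
      + p.k₁ • v p (2 * m) + p.k₁⁻¹ • v p (2 * m + 1) := by
  obtain ⟨n, hn⟩ := p.odd_d
  rcases Nat.lt_or_ge p.d (2 * m) with h | h
  · rw [v_zero p h, v_zero p (show p.d < 2 * m + 1 by omega), map_zero, smul_zero, add_zero,
      smul_zero, add_zero]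
    rcases Nat.lt_or_ge (p.d + 1) (2 * m) with h' | h'
    · rw [v_zero p (by omega), smul_zero]
    · rw [show 2 * m = p.d + 1 by omega, k₀_sq_mul]; simp
  · rw [T_v p _ (by omega)]
    simp only [tv, t1v]
    split_ifs with h1 h3
    · simp [h1]
    · rfl
    · exact absurd (even_two_mul m) h3

theorem T_one_odd (m : ℕ) : T p 1 (v p (2 * m + 1)) = p.k₁⁻¹ • v p (2 * m + 1) := by
  rcases Nat.lt_or_ge p.d (2 * m + 1) with h | h
  · simp [v_zero p h]
  · rw [T_v p _ (by omega)]
    simp [tv, t1v]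

theorem T_two_even [NonRootOfUnity q] (m : ℕ) : T p 2 (v p (2 * m)) =
    (p.k₀⁻¹ * p.k₁⁻¹ * p.k₃⁻¹ * (q ^ (2 * m) * q)⁻¹) • (v p (2 * m) - v p (2 * m + 1)) := by
  rcases Nat.lt_or_ge p.d (2 * m) with h | h
  · simp [v_zero p h, v_zero p (show p.d < 2 * m + 1 by omega)]
  · rw [T_v p _ (by omega)]
    simp only [tv, t2v]
    rw [if_pos (even_two_mul m), zpow_aux]

theorem T_two_odd (m : ℕ) : T p 2 (v p (2 * m + 1)) =
    ((p.k₀ * p.k₁ * p.k₃ * q ^ (2 * m + 1) - p.k₂) * (p.k₀ * p.k₁ * p.k₃ * q ^ (2 * m + 1) - p.k₂⁻¹)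
        / (p.k₀ * p.k₁ * p.k₃ * q ^ (2 * m + 1))) • v p (2 * m)
      + (p.k₂ + p.k₂⁻¹ - p.k₀⁻¹ * p.k₁⁻¹ * p.k₃⁻¹ * (q ^ (2 * m + 1))⁻¹) • v p (2 * m + 1) := by
  obtain ⟨n, hn⟩ := p.odd_d
  rcases Nat.lt_or_ge p.d (2 * m + 1) with h | h
  · simp [v_zero p h, v_zero p (show p.d < 2 * m by omega)]
  · rw [T_v p _ (by omega)]
    simp only [tv, t2v]
    rw [if_neg (by simp), zpow_neg, zpow_natCast]
    rfl

theorem T_three_even (m : ℕ) : T p 3 (v p (2 * m)) = p.k₃ • v p (2 * m) := by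
  rcases Nat.lt_or_ge p.d (2 * m) with h | h
  · simp [v_zero p h]
  · rw [T_v p _ (by omega)]
    simp [tv, t3v]

theorem T_three_odd (m : ℕ) : T p 3 (v p (2 * m + 1)) =
    (-p.k₃⁻¹ * (p.k₀ * p.k₁ * p.k₃ * q ^ (2 * m + 1) - p.k₂)
        * (p.k₀ * p.k₁ * p.k₃ * q ^ (2 * m + 1) - p.k₂⁻¹)) • v p (2 * m)
      + p.k₃⁻¹ • v p (2 * m + 1) + p.k₃ • v p (2 * m + 2) := by
  obtain ⟨n, hn⟩ := p.odd_d
  rcases Nat.lt_or_ge p.d (2 * m + 1) with h | h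
  · simp [v_zero p h, v_zero p (show p.d < 2 * m by omega),
      v_zero p (show p.d < 2 * m + 2 by omega)]
  · rw [T_v p _ (by omega)]
    simp only [tv, t3v]
    split_ifs with h1 h2
    · exact absurd h1 (by simp)
    · rw [← h2, v_zero p (show p.d < 2 * m + 2 by omega), smul_zero, add_zero]
      rfl
    · rfl

theorem ext_v {φ ψ : Module.End F (EModule p)} (h0 : ∀ m, q ^ (2 * m) = 1 → φ (v p (2 * m)) = ψ (v p (2 * m)))
    (h1 : ∀ m, φ (v p (2 * m + 1)) = ψ (v p (2 * m + 1)))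
    (h2 : ∀ m, φ (v p (2 * m + 2)) = ψ (v p (2 * m + 2))) : φ = ψ := by
  have h : ∀ i, φ (v p i) = ψ (v p i) := fun i => by
    rcases Nat.even_or_odd' i with ⟨m, rfl | rfl⟩
    · rcases m with _ | m
      · exact h0 0 (by simp)
      · exact h2 m
    · exact h1 m
  refine (basis p).ext fun i => ?_
  have := h i
  rwa [v, dif_pos i.2] at this

set_option linter.unusedSimpArgs false in
theorem T_sq [NonRootOfUnity q] (j : Fin 4) :
    T p j * T p j = (k p j + (k p j)⁻¹) • T p j - 1 := by
  have hq : q ≠ 0 := NonRootOfUnity.ne_zero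
  have a0 := p.k₀_ne
  have a1 := p.k₁_ne
  have a2 := p.k₂_ne
  have a3 := p.k₃_ne
  have e1 : ∀ m, v p (2 * m + 2) = v p (2 * (m + 1)) := fun _ => rfl
  have e2 : ∀ m, 2 * (m + 1) - 1 = 2 * m + 1 := fun _ => rfl
  have q2 : ∀ m, q ^ (2 * (m + 1)) = q ^ (2 * m) * q * q := fun m => by ring
  have q1 : ∀ m, q ^ (2 * m + 1) = q ^ (2 * m) * q := fun m => by ring
  have qn : ∀ m, q ^ (2 * m) ≠ 0 := fun m => pow_ne_zero _ hq
  fin_cases j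
  all_goals
    apply ext_v
    · intro m hm
      simp only [Fin.zero_eta, Fin.mk_one, Fin.reduceFinMk, Module.End.mul_apply, e1,
        T_zero_even, T_zero_odd, T_one_even, T_one_odd, T_two_even, T_two_odd, T_three_even,
        T_three_odd, map_add, map_sub, map_smul, e2, LinearMap.sub_apply, LinearMap.smul_apply,
        Module.End.one_apply, k, q1, q2, hm, sub_self]
      match_scalars <;> field_simp <;> ring
    all_goals
      intro m
      simp only [Fin.zero_eta, Fin.mk_one, Fin.reduceFinMk, Module.End.mul_apply, e1,
        T_zero_even, T_zero_odd, T_one_even, T_one_odd, T_two_even, T_two_odd, T_three_even,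
        T_three_odd, map_add, map_sub, map_smul, e2, LinearMap.sub_apply, LinearMap.smul_apply,
        Module.End.one_apply, k, q1, q2]
      match_scalars <;> field_simp <;> ring

set_option linter.unusedSimpArgs false in
theorem T_prod [NonRootOfUnity q] : T p 0 * T p 1 * T p 2 * T p 3 = q⁻¹ • 1 := by
  have hq : q ≠ 0 := NonRootOfUnity.ne_zero
  have a0 := p.k₀_ne
  have a1 := p.k₁_ne
  have a2 := p.k₂_ne
  have a3 := p.k₃_ne
  have e1 : ∀ m, v p (2 * m + 2) = v p (2 * (m + 1)) := fun _ => rfl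
  have e2 : ∀ m, 2 * (m + 1) - 1 = 2 * m + 1 := fun _ => rfl
  have q2 : ∀ m, q ^ (2 * (m + 1)) = q ^ (2 * m) * q * q := fun m => by ring
  have q1 : ∀ m, q ^ (2 * m + 1) = q ^ (2 * m) * q := fun m => by ring
  have qn : ∀ m, q ^ (2 * m) ≠ 0 := fun m => pow_ne_zero _ hq
  apply ext_v
  · intro m hm
    simp only [Module.End.mul_apply, e1,
      T_zero_even, T_zero_odd, T_one_even, T_one_odd, T_two_even, T_two_odd, T_three_even,
      T_three_odd, map_add, map_sub, map_smul, e2, LinearMap.smul_apply,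
      Module.End.one_apply, k, q1, q2, hm, sub_self]
    match_scalars <;> field_simp <;> ring
  all_goals
    intro m
    simp only [Module.End.mul_apply, e1,
      T_zero_even, T_zero_odd, T_one_even, T_one_odd, T_two_even, T_two_odd, T_three_even,
      T_three_odd, map_add, map_sub, map_smul, e2, LinearMap.smul_apply,
      Module.End.one_apply, k, q1, q2]
    match_scalars <;> field_simp <;> ring

/-- The representation of `ℌ_q` on `E(k₀, k₁, k₂, k₃)`. -/
noncomputable def rep [NonRootOfUnity q] : DAHA q →ₐ[F] Module.End F (EModule p) :=
  DAHA.lift (T p) (Tinv p)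
    (fun j => by rw [Tinv, mul_sub, T_sq, mul_smul_comm, mul_one]; abel)
    (fun j => by rw [Tinv, sub_mul, T_sq, smul_mul_assoc, one_mul]; abel)
    (fun i j => by
      rw [Tinv, add_sub_cancel]
      exact (Commute.one_left _).smul_left _)
    (by rw [T_prod, Algebra.algebraMap_eq_smul_one])

/-- `E(k₀, k₁, k₂, k₃)` as an `ℌ_q`-module. -/
noncomputable instance [NonRootOfUnity q] : Module (DAHA q) (EModule p) :=
  Module.compHom (EModule p) (rep p).toRingHom

/-- The action of the generators on the basis. -/
theorem t_smul_v [NonRootOfUnity q] (j : Fin 4) {i : ℕ} (h : i ≤ p.d) :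
    DAHA.t q j • v p i = tv p j i := by
  change rep p (DAHA.t q j) (v p i) = _
  rw [rep, DAHA.lift_t, T_v p j (by omega)]

instance [NonRootOfUnity q] : IsScalarTower F (DAHA q) (EModule p) :=
  ⟨fun a x y => by
    change rep p (a • x) y = a • rep p x y
    rw [map_smul, LinearMap.smul_apply]⟩

end EModule

/-- The `ℌ_q`-module `V^ε` obtained by twisting `V` by an automorphism `ε`: the underlying space
is that of `V`, and `x` acts on `V^ε` as `ε x` acts on `V`. -/
def DAHATwist {F : Type*} [Field F] {q : F} (_ε : DAHA q ≃ₐ[F] DAHA q) (V : Type*) : Type _ := V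

section Modules

variable {F : Type*} [Field F] {q : F} (V : Type*) [AddCommGroup V]

instance (ε : DAHA q ≃ₐ[F] DAHA q) : AddCommGroup (DAHATwist ε V) :=
  inferInstanceAs (AddCommGroup V)

instance [Module F V] (ε : DAHA q ≃ₐ[F] DAHA q) : Module F (DAHATwist ε V) :=
  inferInstanceAs (Module F V)

instance [Module (DAHA q) V] (ε : DAHA q ≃ₐ[F] DAHA q) : Module (DAHA q) (DAHATwist ε V) :=
  Module.compHom V ε.toAlgHom.toRingHom

instance [Module F V] [Module (DAHA q) V] [IsScalarTower F (DAHA q) V]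
    (ε : DAHA q ≃ₐ[F] DAHA q) : IsScalarTower F (DAHA q) (DAHATwist ε V) :=
  ⟨fun a x y => by
    change (ε (a • x) • (show V from y)) = a • (ε x • (show V from y))
    rw [map_smul, smul_assoc]⟩

/-- Each `ℌ_q`-module is viewed as a `△_q`-module by pulling back via `ζ`. -/
instance [NonRootOfUnity q] [Module (DAHA q) V] : Module (UAW q) V :=
  Module.compHom V (DAHA.zeta q).toRingHom

theorem DAHA.commute_zeta [NonRootOfUnity q] (x : UAW q) :
    Commute (DAHA.t q 0) (DAHA.zeta q x) := by
  obtain ⟨x, rfl⟩ := UAW.mk_surjective x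
  rw [DAHA.zeta_mk]
  induction x using FreeAlgebra.induction with
  | grade0 r => rw [AlgHom.commutes]; exact (Algebra.commutes r _).symm
  | grade1 g => rw [FreeAlgebra.lift_ι_apply]; exact DAHA.commute_zetaGen q g
  | mul a b ha hb => rw [map_mul]; exact ha.mul_right hb
  | add a b ha hb => rw [map_add]; exact ha.add_right hb

variable (q) in
/-- `V(θ) = {v ∈ V | t_0 v = θ v}`, as a `△_q`-submodule of the `ℌ_q`-module `V`. -/
def t0Eigenspace [NonRootOfUnity q] [Module F V] [Module (DAHA q) V]
    [IsScalarTower F (DAHA q) V] (θ : F) : Submodule (UAW q) V where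
  carrier := {v | DAHA.t q 0 • v = θ • v}
  zero_mem' := by simp
  add_mem' := fun {a b} ha hb => by
    simp only [Set.mem_ofPred_eq] at *
    rw [smul_add, smul_add, ha, hb]
  smul_mem' := fun x v hv => by
    simp only [Set.mem_ofPred_eq] at *
    change DAHA.t q 0 • (DAHA.zeta q x • v) = θ • (DAHA.zeta q x • v)
    rw [smul_smul, (DAHA.commute_zeta x).eq, ← smul_smul, hv, ← algebraMap_smul (DAHA q) θ v,
      smul_smul, ← Algebra.commutes, ← smul_smul, algebraMap_smul]

end Modules

/-- The `ℌ_q`-module `E(k₀, k₁, k₂, k₃)^{2 mod 4}`, the twist of `E(k₀, k₁, k₂, k₃)` by the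
automorphism `t_0, t_1, t_2, t_3 ↦ t_2, t_3, t_0, t_1`. -/
abbrev ETwist2 {F : Type*} [Field F] {q : F} (p : EParam q) : Type _ :=
  DAHATwist (DAHA.shift q 2) (EModule p)

set_option linter.unusedSectionVars false

/-! ### `ℌ_q`-modules over `F` on which every `t_i + t_i⁻¹` is a scalar. -/

section DAHAModule

variable {F : Type*} [Field F] {q : F} [NonRootOfUnity q]
variable {V : Type*} [AddCommGroup V] [Module F V] [Module (DAHA q) V] [IsScalarTower F (DAHA q) V]

/-! Put V = E², on which `t₀` acts as the old `t₂`, and write θ = k₂, η = k₂⁻¹, so that (t₀ - θ)(t₀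
- η) = 0 on V. The maps t₀ - θ and t₀ - η commute with `△_q`, and each eigenspace contains the image
of the complementary factor. The converse inclusion V(θ) ⊆ (t₀ - η)V also holds: the old `t₂`
preserves each plane spanned by v_{2m}, v_{2m+1} and is not scalar there. The explicit homotopy of
`EModule.exists_homotopy` covers θ ≠ η and the Jordan case θ = η together.

Three facts then determine all submodules. First, every `△_q`-submodule is `t₀`-stable
(`UAW.t0_smul_mem`): q²C - q⁻²C + qAB - q⁻¹BA equals a scalar plus a multiple of `t₀`, and that
multiple is nonzero because the scalar of `t₂ + t₂⁻¹` on V is k₀ + k₀⁻¹ ≠ 0. Second, for a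
`t₀`-stable W the space W + t₁W + t₂W + t₃W is already `ℌ_q`-stable (`UAW.t_smul_mem_span`), so by
irreducibility it is V as soon as W ≠ 0. Third, if W lies in V(θ), then (t₀ - η)t_jW ⊆ W; with the
second fact this gives (t₀ - η)V ⊆ W, hence W = V(θ) when W ≠ 0 (`UAW.t0Sub_mem_of_le`).

A submodule W in neither eigenspace has nonzero images under both factors. These images are
submodules of the eigenspaces, hence equal to them, and they lie in W by `t₀`-stability. Now W
contains the kernel V(η) of t₀ - η and has the same image as V under t₀ - η, so W = V. -/

theorem DAHA.smul_smul_comm (a : F) (x : DAHA q) (v : V) : x • (a • v) = a • (x • v) := by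
  rw [← algebraMap_smul (DAHA q) a v, smul_smul, ← Algebra.commutes, ← smul_smul, algebraMap_smul]

theorem UAW.smul_def (x : UAW q) (v : V) : x • v = DAHA.zeta q x • v := rfl

theorem UAW.gen_smul (g : UAWGen) (v : V) : UAW.gen q g • v = DAHA.zetaGen q g • v := by
  rw [UAW.smul_def, DAHA.zeta_gen]

theorem UAW.algebraMap_smul' (a : F) (v : V) : algebraMap F (UAW q) a • v = a • v := by
  rw [UAW.smul_def, AlgHom.commutes, algebraMap_smul]

theorem UAW.field_smul_mem (W : Submodule (UAW q) V) (a : F) {w : V} (hw : w ∈ W) : a • w ∈ W := by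
  rw [← UAW.algebraMap_smul' (q := q)]
  exact W.smul_mem _ hw

theorem UAW.zetaGen_smul_mem (W : Submodule (UAW q) V) (g : UAWGen) {w : V} (hw : w ∈ W) :
    DAHA.zetaGen q g • w ∈ W := by
  rw [← UAW.gen_smul]
  exact W.smul_mem _ hw

/-- The underlying `F`-subspace of a `△_q`-submodule. -/
def UAW.toSubspace (W : Submodule (UAW q) V) : Submodule F V where
  carrier := W
  zero_mem' := W.zero_mem
  add_mem' := W.add_mem
  smul_mem' a _ hw := UAW.field_smul_mem W a hw

/-- The action of an element of `ℌ_q` as an `F`-linear map. -/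
def DAHA.act (x : DAHA q) : V →ₗ[F] V where
  toFun v := x • v
  map_add' := smul_add x
  map_smul' a v := DAHA.smul_smul_comm a x v

/-- `v ↦ t₀ v - θ v` as a `△_q`-linear map. -/
def DAHA.t0Sub (θ : F) : V →ₗ[UAW q] V where
  toFun v := DAHA.t q 0 • v - θ • v
  map_add' v w := by rw [smul_add, smul_add]; abel
  map_smul' x v := by
    rw [RingHom.id_apply, smul_sub, UAW.smul_def, UAW.smul_def, UAW.smul_def, smul_smul,
      (DAHA.commute_zeta x).eq, ← smul_smul, DAHA.smul_smul_comm]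

/-- The elements `t_i + t_i⁻¹` act on `V` as the scalars `c i`. -/
def DAHA.ActsBy (V : Type*) [AddCommGroup V] [Module F V] [Module (DAHA q) V] (c : Fin 4 → F) :
    Prop :=
  ∀ i (v : V), DAHA.t q i • v + DAHA.tinv q i • v = c i • v

variable {c : Fin 4 → F}

theorem DAHA.ActsBy.tinv_smul (hc : DAHA.ActsBy (q := q) V c) (i : Fin 4) (v : V) :
    DAHA.tinv q i • v = c i • v - DAHA.t q i • v := by
  rw [← hc i v]; abel

theorem DAHA.t_smul_t_smul (hc : DAHA.ActsBy (q := q) V c) (i : Fin 4) (v : V) :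
    DAHA.t q i • DAHA.t q i • v = c i • DAHA.t q i • v - v := by
  rw [← hc i (DAHA.t q i • v), smul_smul (DAHA.tinv q i), DAHA.tinv_mul_t, one_smul,
    add_sub_cancel_right]

/-! ### Stability of `△_q`-submodules under `t₀`. -/

/-- By `daha_key`, the action of `t₀` can be recovered from that of A, B, C and scalars, once the
coefficient c₂ of q t₀⁻¹ + q⁻¹ t₀ is nonzero. -/
theorem UAW.t0_smul_mem (hc : DAHA.ActsBy (q := q) V c) (h2 : c 2 ≠ 0) (W : Submodule (UAW q) V)
    {w : V} (hw : w ∈ W) : DAHA.t q 0 • w ∈ W := by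
  have hq : q ≠ 0 := NonRootOfUnity.ne_zero
  have hqq : q * q - 1 ≠ 0 := fun h => NonRootOfUnity.pow_ne_one (q := q) 2 (by norm_num)
    (by linear_combination h)
  have hq1 : q - q⁻¹ ≠ 0 := by
    intro h
    field_simp at h
    exact hqq (by linear_combination h)
  have key := congrArg (· • w) (daha_key hq (DAHA.tinv_mul_t q 0) (DAHA.tinv_mul_t q 1)
    (DAHA.t_mul_tinv q 2) (DAHA.t_mul_tinv q 3) (DAHA.c_central q 0) (DAHA.c_central q 1)
    (DAHA.c_central q 2) (DAHA.c_central q 3) (DAHA.t_prod q))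
  beta_reduce at key
  have hA := fun {w : V} (hw : w ∈ W) => UAW.zetaGen_smul_mem W .A hw
  have hB := fun {w : V} (hw : w ∈ W) => UAW.zetaGen_smul_mem W .B hw
  have hC := fun {w : V} (hw : w ∈ W) => UAW.zetaGen_smul_mem W .C hw
  simp only [DAHA.zetaGen] at hA hB hC
  have hL := W.add_mem (UAW.field_smul_mem W (q ^ 2 - q⁻¹ ^ 2) (hC hw))
    (W.sub_mem (UAW.field_smul_mem W q (hA (hB hw))) (UAW.field_smul_mem W q⁻¹ (hB (hA hw))))
  -- Substituting t₀⁻¹ = c₀ - t₀ turns q t₀⁻¹ + q⁻¹ t₀ into q c₀ + (q⁻¹ - q) t₀; this isolates `t₀`.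
  have e : ((q - q⁻¹) * (q⁻¹ - q) * c 2) • (DAHA.t q 0 • w)
      = (q - q⁻¹) • ((c 1 * c 3) • w + c 2 • (q • (c 0 • w - DAHA.t q 0 • w)
        + q⁻¹ • (DAHA.t q 0 • w))) - ((q - q⁻¹) * (c 1 * c 3 + c 2 * q * c 0)) • w := by
    generalize DAHA.t q 0 • w = x
    module
  have hR : ((DAHA.t q 1 + DAHA.tinv q 1) * (DAHA.t q 3 + DAHA.tinv q 3) +
      (DAHA.t q 2 + DAHA.tinv q 2) * (q • DAHA.tinv q 0 + q⁻¹ • DAHA.t q 0)) • w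
      = (c 1 * c 3) • w + c 2 • (q • (c 0 • w - DAHA.t q 0 • w) + q⁻¹ • (DAHA.t q 0 • w)) := by
    have hc' : ∀ i (v : V), (DAHA.t q i + DAHA.tinv q i) • v = c i • v := fun i v => by
      rw [add_smul, hc]
    rw [add_smul, mul_smul, mul_smul, hc', hc', hc', mul_smul, add_smul, smul_assoc q,
      smul_assoc q⁻¹, hc.tinv_smul]
  have key' : (q - q⁻¹) • ((c 1 * c 3) • w + c 2 • (q • (c 0 • w - DAHA.t q 0 • w)
        + q⁻¹ • (DAHA.t q 0 • w))) ∈ W := by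
    rw [← hR, ← smul_assoc (q - q⁻¹), ← key]
    convert hL using 1
    simp only [add_smul, sub_smul, smul_assoc, mul_smul]
  have h := e ▸ W.sub_mem key' (UAW.field_smul_mem W _ hw)
  have hne : (q - q⁻¹) * (q⁻¹ - q) * c 2 ≠ 0 :=
    mul_ne_zero (mul_ne_zero hq1 (by rw [← neg_sub]; exact neg_ne_zero.2 hq1)) h2
  have h' := UAW.field_smul_mem W ((q - q⁻¹) * (q⁻¹ - q) * c 2)⁻¹ h
  rwa [smul_smul, inv_mul_cancel₀ hne, one_smul] at h'

/-! ### The `ℌ_q`-submodule generated by a `t₀`-stable `△_q`-submodule. -/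

/-- `W + t₁W + t₂W + t₃W`; this is the `ℌ_q`-submodule generated by `W` if `W` is `t₀`-stable. -/
def UAW.span (W : Submodule (UAW q) V) : Submodule F V :=
  UAW.toSubspace W ⊔ (UAW.toSubspace W).map (DAHA.act (DAHA.t q 1)) ⊔
    (UAW.toSubspace W).map (DAHA.act (DAHA.t q 2)) ⊔
    (UAW.toSubspace W).map (DAHA.act (DAHA.t q 3))

theorem UAW.span_le {W : Submodule (UAW q) V} {P : Submodule F V} (h0 : ∀ w ∈ W, w ∈ P)
    (h1 : ∀ w ∈ W, DAHA.t q 1 • w ∈ P) (h2 : ∀ w ∈ W, DAHA.t q 2 • w ∈ P)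
    (h3 : ∀ w ∈ W, DAHA.t q 3 • w ∈ P) : UAW.span W ≤ P :=
  sup_le (sup_le (sup_le h0 (Submodule.map_le_iff_le_comap.2 h1))
    (Submodule.map_le_iff_le_comap.2 h2)) (Submodule.map_le_iff_le_comap.2 h3)

theorem UAW.mem_span {W : Submodule (UAW q) V} {w : V} (hw : w ∈ W) : w ∈ UAW.span W :=
  Submodule.mem_sup_left (Submodule.mem_sup_left (Submodule.mem_sup_left hw))

theorem UAW.t1_smul_mem_span {W : Submodule (UAW q) V} {w : V} (hw : w ∈ W) :
    DAHA.t q 1 • w ∈ UAW.span W :=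
  Submodule.mem_sup_left (Submodule.mem_sup_left (Submodule.mem_sup_right ⟨w, hw, rfl⟩))

theorem UAW.t2_smul_mem_span {W : Submodule (UAW q) V} {w : V} (hw : w ∈ W) :
    DAHA.t q 2 • w ∈ UAW.span W :=
  Submodule.mem_sup_left (Submodule.mem_sup_right ⟨w, hw, rfl⟩)

theorem UAW.t3_smul_mem_span {W : Submodule (UAW q) V} {w : V} (hw : w ∈ W) :
    DAHA.t q 3 • w ∈ UAW.span W :=
  Submodule.mem_sup_right ⟨w, hw, rfl⟩

/-- `t₀ t_j = (t_j t₀ + (t_j t₀)⁻¹) - t_j⁻¹ t₀⁻¹`. -/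
theorem DAHA.t0_smul_t_smul (hc : DAHA.ActsBy (q := q) V c) (j : Fin 4) (w : V) :
    DAHA.t q 0 • DAHA.t q j • w = (DAHA.t q j * DAHA.t q 0 + DAHA.tinv q 0 * DAHA.tinv q j) • w
      - c j • (c 0 • w - DAHA.t q 0 • w) + DAHA.t q j • (c 0 • w - DAHA.t q 0 • w) := by
  rw [← daha_swap (DAHA.c_central q 0) (DAHA.c_central q j), add_smul, mul_smul, mul_smul,
    ← hc.tinv_smul 0, hc.tinv_smul j (DAHA.tinv q 0 • w)]
  abel

/-- Each product t_i t_j applied to W must fall back into the sum. Products with i = 0 are reduced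
by the images of A, B, C, squares by the quadratic relations, and the remaining products by cyclic
forms of t₀t₁t₂t₃ = q⁻¹, which trade two generators for the other two. -/
theorem UAW.t_smul_mem_span (hc : DAHA.ActsBy (q := q) V c) {W : Submodule (UAW q) V}
    (h0 : ∀ w ∈ W, DAHA.t q 0 • w ∈ W) (i : Fin 4) {v : V} (hv : v ∈ UAW.span W) :
    DAHA.t q i • v ∈ UAW.span W := by
  have hq : q ≠ 0 := NonRootOfUnity.ne_zero
  have hF := fun (a : F) {w : V} (hw : w ∈ W) => UAW.field_smul_mem W a hw
  have hS := fun (a : F) {w : V} (hw : w ∈ UAW.span W) => (UAW.span W).smul_mem a hw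
  have hA := fun {w : V} (hw : w ∈ W) => UAW.zetaGen_smul_mem W .A hw
  have hB := fun {w : V} (hw : w ∈ W) => UAW.zetaGen_smul_mem W .B hw
  have hC := fun {w : V} (hw : w ∈ W) => UAW.zetaGen_smul_mem W .C hw
  have i0 : ∀ w ∈ W, DAHA.tinv q 0 • w ∈ W := fun w hw => by
    rw [hc.tinv_smul]; exact W.sub_mem (hF _ hw) (h0 w hw)
  have m0 := fun {w : V} (hw : w ∈ W) => UAW.mem_span hw
  have m1 := fun {w : V} (hw : w ∈ W) => UAW.t1_smul_mem_span hw
  have m2 := fun {w : V} (hw : w ∈ W) => UAW.t2_smul_mem_span hw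
  have m3 := fun {w : V} (hw : w ∈ W) => UAW.t3_smul_mem_span hw
  -- Since t_i + t_i⁻¹ is scalar, t_i and t_i⁻¹ are interchangeable when testing membership of the
  -- image of a vector already in the span.
  have cinv : ∀ (i : Fin 4) {v : V}, v ∈ UAW.span W → DAHA.t q i • v ∈ UAW.span W →
      DAHA.tinv q i • v ∈ UAW.span W := fun i v h h' => by
    rw [hc.tinv_smul]; exact Submodule.sub_mem _ (hS _ h) h'
  have ct : ∀ (i : Fin 4) {v : V}, v ∈ UAW.span W → DAHA.tinv q i • v ∈ UAW.span W →
      DAHA.t q i • v ∈ UAW.span W := fun i v h h' => by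
    have : DAHA.t q i • v = c i • v - DAHA.tinv q i • v := by rw [hc.tinv_smul]; abel
    rw [this]; exact Submodule.sub_mem _ (hS _ h) h'
  have s0 : ∀ j, (∀ {w : V}, w ∈ W → DAHA.t q j • w ∈ UAW.span W) →
      (∀ {w : V}, w ∈ W → (DAHA.t q j * DAHA.t q 0 + DAHA.tinv q 0 * DAHA.tinv q j) • w ∈ W) →
      ∀ {w : V}, w ∈ W → DAHA.t q 0 • DAHA.t q j • w ∈ UAW.span W := fun j hj hZ w hw => by
    have h := W.sub_mem (hF (c 0) hw) (h0 w hw)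
    rw [DAHA.t0_smul_t_smul hc]
    exact Submodule.add_mem _ (m0 (W.sub_mem (hZ hw) (hF _ h))) (hj h)
  have h01 := fun {w : V} (hw : w ∈ W) => s0 1 m1 hA hw
  have h02 := fun {w : V} (hw : w ∈ W) => s0 2 m2 hC hw
  have h03 := fun {w : V} (hw : w ∈ W) => s0 3 m3 hB hw
  have it : ∀ (i : Fin 4) (v : V), DAHA.tinv q i • DAHA.t q i • v = v := fun i v => by
    rw [smul_smul, DAHA.tinv_mul_t, one_smul]
  have ti : ∀ (i : Fin 4) (v : V), DAHA.t q i • DAHA.tinv q i • v = v := fun i v => by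
    rw [smul_smul, DAHA.t_mul_tinv, one_smul]
  -- The product relation and its three cyclic rotations, each obtained from the previous one by
  -- conjugation.
  have p0 : ∀ v : V, DAHA.t q 0 • DAHA.t q 1 • DAHA.t q 2 • DAHA.t q 3 • v = q⁻¹ • v := fun v => by
    rw [← algebraMap_smul (DAHA q) q⁻¹ v, ← DAHA.t_prod]; simp only [mul_smul]
  have p1 : ∀ v : V, DAHA.t q 1 • DAHA.t q 2 • DAHA.t q 3 • DAHA.t q 0 • v = q⁻¹ • v := fun v => by
    rw [← it 0 (DAHA.t q 1 • _), p0, DAHA.smul_smul_comm, it]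
  have p2 : ∀ v : V, DAHA.t q 2 • DAHA.t q 3 • DAHA.t q 0 • DAHA.t q 1 • v = q⁻¹ • v := fun v => by
    rw [← it 1 (DAHA.t q 2 • _), p1, DAHA.smul_smul_comm, it]
  have p3 : ∀ v : V, DAHA.t q 3 • DAHA.t q 0 • DAHA.t q 1 • DAHA.t q 2 • v = q⁻¹ • v := fun v => by
    rw [← it 2 (DAHA.t q 3 • _), p2, DAHA.smul_smul_comm, it]
  have h11 : ∀ {w : V}, w ∈ W → DAHA.t q 1 • DAHA.t q 1 • w ∈ UAW.span W := fun hw => by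
    rw [DAHA.t_smul_t_smul hc]; exact Submodule.sub_mem _ (hS _ (m1 hw)) (m0 hw)
  have h22 : ∀ {w : V}, w ∈ W → DAHA.t q 2 • DAHA.t q 2 • w ∈ UAW.span W := fun hw => by
    rw [DAHA.t_smul_t_smul hc]; exact Submodule.sub_mem _ (hS _ (m2 hw)) (m0 hw)
  have h33 : ∀ {w : V}, w ∈ W → DAHA.t q 3 • DAHA.t q 3 • w ∈ UAW.span W := fun hw => by
    rw [DAHA.t_smul_t_smul hc]; exact Submodule.sub_mem _ (hS _ (m3 hw)) (m0 hw)
  -- `t₁t₂ = q⁻¹ t₀⁻¹ t₃⁻¹`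
  have h12 : ∀ {w : V}, w ∈ W → DAHA.t q 1 • DAHA.t q 2 • w ∈ UAW.span W := fun {w} hw => by
    have e : DAHA.t q 1 • DAHA.t q 2 • w = q⁻¹ • DAHA.tinv q 0 • DAHA.tinv q 3 • w := by
      rw [← DAHA.smul_smul_comm, ← DAHA.smul_smul_comm, ← p3 w, it, it]
    rw [e]
    refine hS _ (cinv 0 (cinv 3 (m0 hw) (m3 hw)) ?_)
    rw [hc.tinv_smul, smul_sub, DAHA.smul_smul_comm]
    exact Submodule.sub_mem _ (hS _ (m0 (h0 w hw))) (h03 hw)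
  -- `t₂⁻¹t₁⁻¹ = q t₃t₀`
  have h21 : ∀ {w : V}, w ∈ W → DAHA.t q 2 • DAHA.t q 1 • w ∈ UAW.span W := fun {w} hw => by
    have e : DAHA.tinv q 2 • DAHA.tinv q 1 • w = q • DAHA.t q 3 • DAHA.t q 0 • w := by
      have h : DAHA.tinv q 2 • DAHA.tinv q 1 • q⁻¹ • w = DAHA.t q 3 • DAHA.t q 0 • w := by
        rw [← p1, it, it]
      rw [← h, DAHA.smul_smul_comm, DAHA.smul_smul_comm, smul_inv_smul₀ hq]
    have e' : DAHA.tinv q 2 • DAHA.t q 1 • w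
        = c 1 • DAHA.tinv q 2 • w - DAHA.tinv q 2 • DAHA.tinv q 1 • w := by
      rw [hc.tinv_smul 1, smul_sub, DAHA.smul_smul_comm]; abel
    refine ct 2 (m1 hw) ?_
    rw [e', e]
    exact Submodule.sub_mem _ (hS _ (cinv 2 (m0 hw) (m2 hw))) (hS _ (m3 (h0 w hw)))
  -- `t₂t₃ = q⁻¹ t₁⁻¹t₀⁻¹`
  have h23 : ∀ {w : V}, w ∈ W → DAHA.t q 2 • DAHA.t q 3 • w ∈ UAW.span W := fun {w} hw => by
    have e : DAHA.t q 2 • DAHA.t q 3 • w = q⁻¹ • DAHA.tinv q 1 • DAHA.tinv q 0 • w := by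
      rw [← DAHA.smul_smul_comm, ← DAHA.smul_smul_comm, ← p0 w, it, it]
    rw [e]
    exact hS _ (cinv 1 (m0 (i0 w hw)) (m1 (i0 w hw)))
  -- `t₃⁻¹t₂⁻¹ = q t₀t₁`
  have h32 : ∀ {w : V}, w ∈ W → DAHA.t q 3 • DAHA.t q 2 • w ∈ UAW.span W := fun {w} hw => by
    have e : DAHA.tinv q 3 • DAHA.tinv q 2 • w = q • DAHA.t q 0 • DAHA.t q 1 • w := by
      have h : DAHA.tinv q 3 • DAHA.tinv q 2 • q⁻¹ • w = DAHA.t q 0 • DAHA.t q 1 • w := by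
        rw [← p2, it, it]
      rw [← h, DAHA.smul_smul_comm, DAHA.smul_smul_comm, smul_inv_smul₀ hq]
    have e' : DAHA.tinv q 3 • DAHA.t q 2 • w
        = c 2 • DAHA.tinv q 3 • w - DAHA.tinv q 3 • DAHA.tinv q 2 • w := by
      rw [hc.tinv_smul 2, smul_sub, DAHA.smul_smul_comm]; abel
    refine ct 3 (m2 hw) ?_
    rw [e', e]
    exact Submodule.sub_mem _ (hS _ (cinv 3 (m0 hw) (m3 hw))) (hS _ (h01 hw))
  -- `t₃ t₁⁻¹ = (t₃ A - q⁻¹ t₂⁻¹) t₀`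
  have h31 : ∀ {w : V}, w ∈ W → DAHA.t q 3 • DAHA.t q 1 • w ∈ UAW.span W := fun {w} hw => by
    have hu := h0 w hw
    have e : DAHA.t q 3 • DAHA.tinv q 1 • w = DAHA.t q 3 • DAHA.zetaGen q .A • DAHA.t q 0 • w
        - q⁻¹ • DAHA.tinv q 2 • DAHA.t q 0 • w := by
      have h := p3 (DAHA.tinv q 2 • DAHA.t q 0 • w)
      rw [ti] at h
      rw [← h, DAHA.zetaGen,
        ← daha_swap (DAHA.c_central q 0) (DAHA.c_central q 1), add_smul, mul_smul, mul_smul, it,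
        smul_add]
      abel
    have e' : DAHA.t q 3 • DAHA.t q 1 • w
        = c 1 • DAHA.t q 3 • w - DAHA.t q 3 • DAHA.tinv q 1 • w := by
      rw [hc.tinv_smul 1, smul_sub, DAHA.smul_smul_comm]; abel
    rw [e', e]
    exact Submodule.sub_mem _ (hS _ (m3 hw)) (Submodule.sub_mem _ (m3 (hA hu))
      (hS _ (cinv 2 (m0 hu) (m2 hu))))
  -- `t₁⁻¹ t₃ = (t₁⁻¹ B - q t₂) t₀⁻¹`
  have h13 : ∀ {w : V}, w ∈ W → DAHA.t q 1 • DAHA.t q 3 • w ∈ UAW.span W := fun {w} hw => by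
    have hu := i0 w hw
    have e : DAHA.tinv q 1 • DAHA.t q 3 • w = DAHA.tinv q 1 • DAHA.zetaGen q .B • DAHA.tinv q 0 • w
        - q • DAHA.t q 2 • DAHA.tinv q 0 • w := by
      have h : DAHA.tinv q 1 • DAHA.tinv q 0 • DAHA.tinv q 3 • q⁻¹ • DAHA.tinv q 0 • w
          = DAHA.t q 2 • DAHA.tinv q 0 • w := by
        rw [← p3, it, it, it]
      rw [← h, DAHA.smul_smul_comm, DAHA.smul_smul_comm, DAHA.smul_smul_comm, smul_inv_smul₀ hq,
        DAHA.zetaGen, add_smul, mul_smul, mul_smul, ti, smul_add]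
      abel
    refine ct 1 (m3 hw) ?_
    rw [e]
    exact Submodule.sub_mem _ (cinv 1 (m0 (hB hu)) (m1 (hB hu))) (hS _ (m2 hu))
  have hle : UAW.span W ≤ (UAW.span W).comap (DAHA.act (DAHA.t q i)) := by
    fin_cases i
    · exact UAW.span_le (fun w hw => m0 (h0 w hw)) (fun w hw => h01 hw) (fun w hw => h02 hw)
        (fun w hw => h03 hw)
    · exact UAW.span_le (fun w hw => m1 hw) (fun w hw => h11 hw) (fun w hw => h12 hw)
        (fun w hw => h13 hw)
    · exact UAW.span_le (fun w hw => m2 hw) (fun w hw => h21 hw) (fun w hw => h22 hw)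
        (fun w hw => h23 hw)
    · exact UAW.span_le (fun w hw => m3 hw) (fun w hw => h31 hw) (fun w hw => h32 hw)
        (fun w hw => h33 hw)
  exact hle hv

theorem UAW.smul_mem_span (hc : DAHA.ActsBy (q := q) V c) {W : Submodule (UAW q) V}
    (h0 : ∀ w ∈ W, DAHA.t q 0 • w ∈ W) (x : DAHA q) {v : V} (hv : v ∈ UAW.span W) :
    x • v ∈ UAW.span W := by
  obtain ⟨x, rfl⟩ := DAHA.mk_surjective q x
  induction x using FreeAlgebra.induction generalizing v with
  | grade0 r =>
    rw [AlgHom.commutes, algebraMap_smul]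
    exact Submodule.smul_mem _ _ hv
  | grade1 g =>
    rcases g with i | i
    · exact UAW.t_smul_mem_span hc h0 i hv
    · change DAHA.tinv q i • v ∈ _
      rw [hc.tinv_smul]
      exact Submodule.sub_mem _ (Submodule.smul_mem _ _ hv) (UAW.t_smul_mem_span hc h0 i hv)
  | mul a b ha hb =>
    rw [map_mul, mul_smul]
    exact ha (hb hv)
  | add a b ha hb =>
    rw [map_add, add_smul]
    exact Submodule.add_mem _ (ha hv) (hb hv)

/-- The span is `ℌ_q`-stable and contains W, so irreducibility leaves no other possibility. -/
theorem UAW.span_eq_top [IsSimpleModule (DAHA q) V] (hc : DAHA.ActsBy (q := q) V c)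
    {W : Submodule (UAW q) V} (h0 : ∀ w ∈ W, DAHA.t q 0 • w ∈ W) (hW : W ≠ ⊥) (v : V) :
    v ∈ UAW.span W := by
  let M : Submodule (DAHA q) V :=
    { carrier := UAW.span W
      zero_mem' := Submodule.zero_mem _
      add_mem' := Submodule.add_mem _
      smul_mem' := fun x _ hv => UAW.smul_mem_span hc h0 x hv }
  obtain ⟨w, hw, hw0⟩ := W.exists_mem_ne_zero_of_ne_bot hW
  have hM : M = ⊤ := (eq_bot_or_eq_top M).resolve_left fun h => hw0 <| by
    have : w ∈ M := UAW.mem_span hw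
    rwa [h, Submodule.mem_bot] at this
  exact (hM ▸ Submodule.mem_top : v ∈ M)

/-! ### Eigenspaces of `t₀` and the classification of submodules. -/

theorem mem_t0Eigenspace {θ : F} {v : V} :
    v ∈ t0Eigenspace q V θ ↔ DAHA.t q 0 • v = θ • v := Iff.rfl

theorem mem_t0Eigenspace_iff_t0Sub {θ : F} {v : V} :
    v ∈ t0Eigenspace q V θ ↔ DAHA.t0Sub (q := q) θ v = 0 := by
  rw [mem_t0Eigenspace, ← sub_eq_zero]; rfl

/-- The quadratic relation of `t₀`: `t₀ - θ⁻¹` maps into `V(θ)`. -/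
theorem DAHA.t0Sub_mem (hc : DAHA.ActsBy (q := q) V c) {θ η : F} (hs : θ + η = c 0)
    (hp : θ * η = 1) (v : V) : DAHA.t0Sub (q := q) η v ∈ t0Eigenspace q V θ := by
  rw [mem_t0Eigenspace]
  change DAHA.t q 0 • (DAHA.t q 0 • v - η • v) = θ • (DAHA.t q 0 • v - η • v)
  rw [smul_sub, DAHA.t_smul_t_smul hc, DAHA.smul_smul_comm, ← hs]
  generalize DAHA.t q 0 • v = x
  calc (θ + η) • x - v - η • x = (θ + η) • x - (θ * η) • v - η • x := by rw [hp, one_smul]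
    _ = θ • (x - η • v) := by module

/-- A nonzero `△_q`-submodule of `V(θ)` contains the image of `t₀ - θ⁻¹`. -/
theorem UAW.t0Sub_mem_of_le [IsSimpleModule (DAHA q) V] (hc : DAHA.ActsBy (q := q) V c) {θ η : F}
    (hs : θ + η = c 0) {W : Submodule (UAW q) V} (hW : W ≠ ⊥)
    (hle : W ≤ t0Eigenspace q V θ) (v : V) : DAHA.t0Sub (q := q) η v ∈ W := by
  have h0 : ∀ w ∈ W, DAHA.t q 0 • w = θ • w := fun w hw => hle hw
  have h0' : ∀ w ∈ W, DAHA.t q 0 • w ∈ W := fun w hw => by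
    rw [h0 w hw]; exact UAW.field_smul_mem W _ hw
  -- On W the element t₀⁻¹ acts as c₀ - θ = η. So t₀t_j w = Z w - t_j⁻¹(η w), with Z the image of A,
  -- B or C, and replacing t_j⁻¹ by c_j - t_j gives (t₀ - η)t_j w = Z w - c_j η w, which is in W.
  have key : ∀ j, (∀ {w : V}, w ∈ W →
      (DAHA.t q j * DAHA.t q 0 + DAHA.tinv q 0 * DAHA.tinv q j) • w ∈ W) →
      ∀ w ∈ W, DAHA.t0Sub (q := q) η (DAHA.t q j • w) ∈ W := fun j hZ w hw => by
    have e : DAHA.t0Sub (q := q) η (DAHA.t q j • w)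
        = (DAHA.t q j * DAHA.t q 0 + DAHA.tinv q 0 * DAHA.tinv q j) • w - (c j * η) • w := by
      change DAHA.t q 0 • DAHA.t q j • w - η • DAHA.t q j • w = _
      rw [DAHA.t0_smul_t_smul hc, h0 w hw, ← sub_smul, ← hs, DAHA.smul_smul_comm]
      generalize DAHA.t q j • w = x
      generalize (DAHA.t q j * DAHA.t q 0 + DAHA.tinv q 0 * DAHA.tinv q j) • w = y
      module
    rw [e]
    exact W.sub_mem (hZ hw) (UAW.field_smul_mem W _ hw)
  -- The preimage of W under t₀ - η contains W and every t_jW, hence contains their sum, which is V.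
  let P : Submodule F V := (UAW.toSubspace W).comap (DAHA.act (DAHA.t q 0) - η • LinearMap.id)
  exact (UAW.span_le (P := P) (fun w hw => W.sub_mem (h0' w hw) (UAW.field_smul_mem W _ hw))
    (key 1 (UAW.zetaGen_smul_mem W .A)) (key 2 (UAW.zetaGen_smul_mem W .C))
    (key 3 (UAW.zetaGen_smul_mem W .B))) (UAW.span_eq_top hc h0' hW v)

/-- If `V(θ)`, `V(θ⁻¹)` are the images of `t₀ - θ⁻¹`, `t₀ - θ` respectively, then they are simple
or zero, and they are the only nontrivial proper `△_q`-submodules of `V`. -/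
theorem UAW.submodule_classification [IsSimpleModule (DAHA q) V]
    (hc : DAHA.ActsBy (q := q) V c) (h2 : c 2 ≠ 0) {θ η : F} (hs : θ + η = c 0) (hp : θ * η = 1)
    (hθ : t0Eigenspace q V θ ≤ LinearMap.range (DAHA.t0Sub (q := q) η))
    (hη : t0Eigenspace q V η ≤ LinearMap.range (DAHA.t0Sub (q := q) θ))
    (W : Submodule (UAW q) V) :
    W = ⊥ ∨ W = t0Eigenspace q V θ ∨ W = t0Eigenspace q V η ∨ W = ⊤ := by
  have hs' : η + θ = c 0 := by rw [add_comm, hs]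
  have hp' : η * θ = 1 := by rw [mul_comm, hp]
  -- Stated for a general pair so that it serves both eigenspaces: a nonzero U ≤ V(θ) contains (t₀ -
  -- η)V, and this contains V(θ).
  have simple : ∀ {θ η : F}, θ + η = c 0 →
      t0Eigenspace q V θ ≤ LinearMap.range (DAHA.t0Sub (q := q) η) →
      ∀ U : Submodule (UAW q) V, U ≠ ⊥ → U ≤ t0Eigenspace q V θ → U = t0Eigenspace q V θ := by
    intro θ η hs h U hU hle
    refine le_antisymm hle fun v hv => ?_
    obtain ⟨u, rfl⟩ := h hv
    exact UAW.t0Sub_mem_of_le hc hs hU hle u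
  by_cases hbot : W = ⊥
  · exact .inl hbot
  by_cases h1 : W ≤ t0Eigenspace q V θ
  · exact .inr (.inl (simple hs hθ W hbot h1))
  by_cases h3 : W ≤ t0Eigenspace q V η
  · exact .inr (.inr (.inl (simple hs' hη W hbot h3)))
  refine .inr (.inr (.inr ?_))
  -- V(η) is the kernel of t₀ - η, so the image of W is nonzero, and it lies in V(θ).
  have image : ∀ {θ η : F}, θ + η = c 0 → θ * η = 1 →
      t0Eigenspace q V θ ≤ LinearMap.range (DAHA.t0Sub (q := q) η) → ¬ W ≤ t0Eigenspace q V η →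
      W.map (DAHA.t0Sub (q := q) η) = t0Eigenspace q V θ := by
    intro θ η hs hp h hW
    refine simple hs h _ (fun hb => hW fun w hw => ?_) ?_
    · rw [mem_t0Eigenspace_iff_t0Sub, ← Submodule.mem_bot (UAW q), ← hb]
      exact Submodule.mem_map_of_mem hw
    · rintro _ ⟨w, -, rfl⟩
      exact DAHA.t0Sub_mem hc hs hp w
  have map_le : ∀ η : F, W.map (DAHA.t0Sub (q := q) η) ≤ W := by
    rintro η _ ⟨w, hw, rfl⟩
    exact W.sub_mem (UAW.t0_smul_mem hc h2 W hw) (UAW.field_smul_mem W _ hw)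
  refine eq_top_iff.2 fun v _ => ?_
  -- As (t₀ - η)v lies in V(θ) = (t₀ - η)W, some w in W has the same image. Then v - w lies in V(η)
  -- = (t₀ - θ)W ⊆ W. Nothing here needs θ ≠ η.
  have hv : DAHA.t0Sub (q := q) η v ∈ W.map (DAHA.t0Sub (q := q) η) := by
    rw [image hs hp hθ h3]
    exact DAHA.t0Sub_mem hc hs hp v
  obtain ⟨w, hw, e⟩ := hv
  have hvw : v - w ∈ t0Eigenspace q V η := by
    rw [mem_t0Eigenspace_iff_t0Sub, map_sub, e, sub_self]
  rw [← image hs' hp' hη h1] at hvw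
  simpa using W.add_mem (map_le _ hvw) hw

end DAHAModule

/-! ### The module E²: its central scalars, irreducibility and eigenspaces. -/

namespace EModule

variable {F : Type*} [Field F] {q : F} [NonRootOfUnity q] (p : EParam q)

theorem twist_t_smul (i : Fin 4) (v : ETwist2 p) :
    DAHA.t q i • v = (T p (i + 2) v : EModule p) := by
  change rep p (DAHA.shiftHom 2 (DAHA.t q i)) v = _
  rw [DAHA.shiftHom_t, rep, DAHA.lift_t]

theorem twist_tinv_smul (i : Fin 4) (v : ETwist2 p) :
    DAHA.tinv q i • v = (Tinv p (i + 2) v : EModule p) := by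
  change rep p (DAHA.shiftHom 2 (DAHA.tinv q i)) v = _
  rw [DAHA.shiftHom_tinv, rep, DAHA.lift_tinv]

theorem T_add_Tinv (j : Fin 4) (v : EModule p) :
    T p j v + Tinv p j v = (k p j + (k p j)⁻¹) • v := by
  rw [Tinv, LinearMap.sub_apply, add_sub_cancel, LinearMap.smul_apply, Module.End.one_apply]

/-- The indices live in `Fin 4`, so the scalar of `t₂ + t₂⁻¹` on E² is k₀ + k₀⁻¹ and that of `t₀ +
t₀⁻¹` is k₂ + k₂⁻¹. -/
theorem twist_actsBy :
    DAHA.ActsBy (q := q) (ETwist2 p) fun i => k p (i + 2) + (k p (i + 2))⁻¹ := fun i v => by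
  rw [twist_t_smul, twist_tinv_smul]
  exact T_add_Tinv p (i + 2) v

/-- Otherwise k₀² = -1, so q^(d+1) = -1 and q would be a root of unity. This is the nonvanishing
that `UAW.t0_smul_mem` requires on E². -/
theorem k₀_add_inv_ne_zero : p.k₀ + p.k₀⁻¹ ≠ 0 := fun h => by
  have h1 : p.k₀ ^ 2 = -1 := by
    have := p.k₀_ne
    field_simp at h
    linear_combination h
  have h2 := k₀_sq_mul p
  refine NonRootOfUnity.pow_ne_one (q := q) (2 * (p.d + 1)) (by omega) ?_
  rw [pow_mul']
  rw [h1] at h2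
  linear_combination (-q ^ (p.d + 1) + 1) * h2

/-- Because ε is surjective, a subspace stable under the twisted action is stable under the original
one. -/
theorem isSimpleModule_twist [IsSimpleModule (DAHA q) (EModule p)] (ε : DAHA q ≃ₐ[F] DAHA q) :
    IsSimpleModule (DAHA q) (DAHATwist ε (EModule p)) := by
  have : Nontrivial (DAHATwist ε (EModule p)) := IsSimpleModule.nontrivial (DAHA q) (EModule p)
  refine { eq_bot_or_eq_top := fun M => ?_ }
  let M' : Submodule (DAHA q) (EModule p) :=
    { carrier := {v | (show DAHATwist ε (EModule p) from v) ∈ M}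
      zero_mem' := M.zero_mem
      add_mem' := M.add_mem
      smul_mem' := fun x v hv => by
        have := M.smul_mem (ε.symm x) hv
        have e : ε.symm x • (show DAHATwist ε (EModule p) from v) = (x • v : EModule p) := by
          change ε (ε.symm x) • v = _
          rw [ε.apply_symm_apply]
        rwa [e] at this }
  rcases eq_bot_or_eq_top M' with h | h
  · exact .inl (SetLike.ext fun v => (SetLike.ext_iff.1 h v :))
  · exact .inr (SetLike.ext fun v => (SetLike.ext_iff.1 h v :))

/-- A homotopy: `(T₂ - η) S + S (T₂ - θ) = 1` if `{θ, η} = {k₂, k₂⁻¹}`. -/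
theorem exists_homotopy {θ η : F} (hs : θ + η = p.k₂ + p.k₂⁻¹) :
    ∃ S : Module.End F (EModule p), (T p 2 - η • 1) * S + S * (T p 2 - θ • 1) = 1 := by
  have hq : q ≠ 0 := NonRootOfUnity.ne_zero
  have a0 := p.k₀_ne
  have a1 := p.k₁_ne
  have a3 := p.k₃_ne
  -- T₂ sends v_{2m} to a multiple of v_{2m} plus -(k₀k₁k₃q^{2m+1})⁻¹ v_{2m+1}. S inverts that last
  -- coefficient and kills the even vectors, so S T₂ fixes each v_{2m}.
  let S : Module.End F (EModule p) := (basis p).constr F fun i =>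
    if Even (i : ℕ) then 0 else (-(p.k₀ * p.k₁ * p.k₃ * q ^ (i : ℕ))) • v p (i - 1)
  have hS : ∀ i, S (v p i) = if Even i then 0 else
      (-(p.k₀ * p.k₁ * p.k₃ * q ^ i)) • v p (i - 1) := fun i => by
    obtain ⟨n, hn⟩ := p.odd_d
    by_cases h : i < p.d + 1
    · rw [v, dif_pos h, Module.Basis.constr_basis]
    · rw [v_zero p (by omega), map_zero]
      split_ifs with h2
      · rfl
      · rw [v_zero p, smul_zero]
        rw [Nat.not_even_iff] at h2
        omega
  have S0 : ∀ m, S (v p (2 * m)) = 0 := fun m => by rw [hS, if_pos (even_two_mul m)]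
  have S1 : ∀ m, S (v p (2 * m + 1)) = (-(p.k₀ * p.k₁ * p.k₃ * q ^ (2 * m + 1))) • v p (2 * m) :=
    fun m => by rw [hS, if_neg (by simp)]; rfl
  have q1 : ∀ m, q ^ (2 * m + 1) = q ^ (2 * m) * q := fun m => by ring
  have even : ∀ m, ((T p 2 - η • 1) * S + S * (T p 2 - θ • 1)) (v p (2 * m)) = v p (2 * m) := by
    intro m
    have qn : q ^ (2 * m) ≠ 0 := pow_ne_zero _ hq
    simp only [LinearMap.add_apply, Module.End.mul_apply, LinearMap.sub_apply,
      LinearMap.smul_apply, Module.End.one_apply, map_sub, map_smul, S0, S1, T_two_even, map_zero,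
      smul_zero, smul_smul, q1, sub_zero, zero_sub, zero_add, ← neg_smul]
    match_scalars
    field_simp
  -- T₂ and S do not link v_{2m} to v_{2m-1}, so the case m = 0 needs no separate treatment.
  refine ⟨S, ext_v p (fun m _ => even m) (fun m => ?_) (fun m => even (m + 1))⟩
  have qn : q ^ (2 * m) ≠ 0 := pow_ne_zero _ hq
  -- Only the trace θ + η enters: since S² = 0 on each plane plays no role, the identity reads T₂S +
  -- ST₂ - (θ + η)S = 1.
  have hθ : θ = p.k₂ + p.k₂⁻¹ - η := by rw [← hs]; ring
  simp only [LinearMap.add_apply, Module.End.mul_apply, LinearMap.sub_apply,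
    LinearMap.smul_apply, Module.End.one_apply, map_add, map_sub, map_smul, S0, S1, T_two_even,
    T_two_odd, smul_zero, q1, hθ]
  match_scalars
  · field_simp
    ring
  · field_simp

/-- If (T₂ - θ)x = 0, the homotopy identity reduces to (T₂ - η)(S x) = x. -/
theorem eigenspace_le_range {θ η : F} (hs : θ + η = p.k₂ + p.k₂⁻¹) :
    t0Eigenspace q (ETwist2 p) θ ≤ LinearMap.range (DAHA.t0Sub (q := q) η) := by
  obtain ⟨S, hS⟩ := exists_homotopy p hs
  intro x hx
  rw [mem_t0Eigenspace, twist_t_smul] at hx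
  refine ⟨S x, ?_⟩
  have h : (T p 2 - θ • 1) (show EModule p from x) = 0 := sub_eq_zero.2 hx
  have e := LinearMap.congr_fun hS (show EModule p from x)
  rw [LinearMap.add_apply, Module.End.mul_apply, Module.End.mul_apply, h, map_zero, add_zero] at e
  change DAHA.t q 0 • (show ETwist2 p from S x) - η • (show ETwist2 p from S x) = x
  rw [twist_t_smul]
  exact e

/-- T₂ is not scalar: T₂v₀ has a nonzero v₁-coordinate, and v₁ is a genuine basis vector because d ≥
1. -/
theorem eigenspace_lt_top (θ : F) : t0Eigenspace q (ETwist2 p) θ < ⊤ := by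
  have hq : q ≠ 0 := NonRootOfUnity.ne_zero
  obtain ⟨n, hn⟩ := p.odd_d
  refine lt_top_iff_ne_top.2 fun h => ?_
  have h0 : (show ETwist2 p from v p 0) ∈ t0Eigenspace q (ETwist2 p) θ := h ▸ Submodule.mem_top
  rw [mem_t0Eigenspace, twist_t_smul] at h0
  have h1 : T p 2 (v p (2 * 0)) = θ • v p 0 := h0
  rw [T_two_even, v, v, dif_pos (by omega), dif_pos (by omega)] at h1
  have h2 := DFunLike.congr_fun (congrArg (basis p).repr h1) ⟨1, by omega⟩
  simp [p.k₀_ne, p.k₁_ne, p.k₃_ne, hq] at h2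

/-- V(θ) contains (t₀ - η)V, so its vanishing would force V(η) = V. -/
theorem bot_lt_eigenspace {θ η : F} (hs : θ + η = p.k₂ + p.k₂⁻¹) (hp : θ * η = 1) :
    ⊥ < t0Eigenspace q (ETwist2 p) θ := by
  refine bot_lt_iff_ne_bot.2 fun h => (eigenspace_lt_top p η).ne (eq_top_iff.2 fun v _ => ?_)
  have := DAHA.t0Sub_mem (twist_actsBy p) hs hp v
  rwa [h, Submodule.mem_bot, ← mem_t0Eigenspace_iff_t0Sub] at this

theorem not_eigenspace_le {θ η : F} (hs : θ + η = p.k₂ + p.k₂⁻¹) (hp : θ * η = 1) (hne : θ ≠ η) :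
    ¬ t0Eigenspace q (ETwist2 p) θ ≤ t0Eigenspace q (ETwist2 p) η := fun h => by
  obtain ⟨v, hv, hv0⟩ := (Submodule.ne_bot_iff _).1 (bot_lt_eigenspace p hs hp).ne'
  have h1 := hv
  have h2 := h hv
  rw [mem_t0Eigenspace] at h1 h2
  rw [h1, ← sub_eq_zero, ← sub_smul, smul_eq_zero] at h2
  exact h2.elim (fun h => hne (sub_eq_zero.1 h)) hv0

end EModule

/-! ### The classification for E². -/

theorem mainTheorem6 {F : Type*} [Field F] [IsAlgClosed F] (q : F) [NonRootOfUnity q]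
    (p : EParam q) (hirr : IsSimpleModule (DAHA q) (EModule p)) :
    (p.k₂ ^ 2 = 1 →
      ⊥ < t0Eigenspace q (ETwist2 p) p.k₂ ∧
      t0Eigenspace q (ETwist2 p) p.k₂ < ⊤ ∧
      ∀ W : Submodule (UAW q) (ETwist2 p),
        W = ⊥ ∨ W = t0Eigenspace q (ETwist2 p) p.k₂ ∨ W = ⊤) ∧
    (p.k₂ ^ 2 ≠ 1 →
      ⊥ < t0Eigenspace q (ETwist2 p) p.k₂ ∧
      t0Eigenspace q (ETwist2 p) p.k₂ < ⊤ ∧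
      ⊥ < t0Eigenspace q (ETwist2 p) p.k₂⁻¹ ∧
      t0Eigenspace q (ETwist2 p) p.k₂⁻¹ < ⊤ ∧
      ¬ t0Eigenspace q (ETwist2 p) p.k₂ ≤ t0Eigenspace q (ETwist2 p) p.k₂⁻¹ ∧
      ¬ t0Eigenspace q (ETwist2 p) p.k₂⁻¹ ≤ t0Eigenspace q (ETwist2 p) p.k₂ ∧
      ∀ W : Submodule (UAW q) (ETwist2 p),
        W = ⊥ ∨ W = t0Eigenspace q (ETwist2 p) p.k₂ ∨
          W = t0Eigenspace q (ETwist2 p) p.k₂⁻¹ ∨ W = ⊤) := by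

  have := hirr
  have := EModule.isSimpleModule_twist p (DAHA.shift q 2)
  have hs : p.k₂ + p.k₂⁻¹ = p.k₂ + p.k₂⁻¹ := rfl
  have hs' : p.k₂⁻¹ + p.k₂ = p.k₂ + p.k₂⁻¹ := add_comm _ _
  have hp : p.k₂ * p.k₂⁻¹ = 1 := mul_inv_cancel₀ p.k₂_ne
  have hp' : p.k₂⁻¹ * p.k₂ = 1 := inv_mul_cancel₀ p.k₂_ne
  have main := UAW.submodule_classification (EModule.twist_actsBy p)
    (EModule.k₀_add_inv_ne_zero p) hs hp (EModule.eigenspace_le_range p hs)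
    (EModule.eigenspace_le_range p hs')
  refine ⟨fun h => ⟨EModule.bot_lt_eigenspace p hs hp, EModule.eigenspace_lt_top p _, fun W => ?_⟩,
    fun h => ?_⟩
  -- For k₂² = 1 the two eigenspaces coincide, and the two middle alternatives merge.
  · have e : p.k₂⁻¹ = p.k₂ := by
      rw [inv_eq_iff_eq_inv, eq_comm]
      exact inv_eq_of_mul_eq_one_left (by rw [← sq, h])
    rcases main W with h | h | h | h
    · exact .inl h
    · exact .inr (.inl h)
    · exact .inr (.inl (by rw [h, e]))
    · exact .inr (.inr h)
  · have hne : p.k₂ ≠ p.k₂⁻¹ := fun e => h (by rw [sq]; nth_rw 2 [e]; exact hp)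
    exact ⟨EModule.bot_lt_eigenspace p hs hp, EModule.eigenspace_lt_top p _,
      EModule.bot_lt_eigenspace p hs' hp', EModule.eigenspace_lt_top p _,
      EModule.not_eigenspace_le p hs hp hne, EModule.not_eigenspace_le p hs' hp' hne.symm, main⟩
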